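/- **Circuits and encodings.** A $\mathsf{TC}^0$ family is a (not necessarily uniform) family of circuits with unbounded fan-in $\mathsf{MAJORITY}$ gates and $\neg$ gates, of constant depth, and of size (gates plus wires) polynomial in the parameters that index the family. Integers are encoded in sign-magnitude form (a sign bit and a binary magnitude), and rationals as a fraction of a signed integer by a nonzero natural number (not necessarily reduced). An object has bit length $w$ if all magnitudes, numerators and denominators occurring in it are written with $w$ bits. **Classes.** Let $\mathcal G$ be the class of integer matrices that have at least one nonzero entry in every row and in every column. Let $\mathcal G_z\subset\mathcal G$ be the class of those matrices in $\mathcal G$ in which every row sums to zero. Let $\mathcal G_{z,2}\subset\mathcal G_z$ be the class of those matrices in $\mathcal G_z$ in which the positive entries of every row sum to a power of $2$ (that is, to $2^k$ for some integer $k\ge 0$). Let $\mathcal{MC}_2$ be the class of (integer) $2$-commodity matrices: the columns are indexed by variables $x_1,\dots,x_k,y_1,\dots,y_k$, and each row is the coefficient vector of a nonzero multiple of $x_i-x_j$, of $y_i-y_j$, or of $x_i-y_i-(x_j-y_j)$, for some $i\neq j$ (columns of $\mathcal{MC}_2$ matrices may be zero). **Reductions.** A $\mathsf{TC}^0$-reduction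 from exactly solving linear systems in a class $\mathcal C$ to exactly solving linear systems in a class $\mathcal D$ consists of two $\mathsf{TC}^0$ families $F=(F_{m,n,w})$, of size $\mathrm{poly}(m,n,w)$, and $R=(R_{m,n,w,\ell})$, of size $\mathrm{poly}(m,n,w,\ell)$, such that for every $m\times n$ matrix $A\in\mathcal C$ and every rational vector $b$, both of bit length $w$: 1. given any encoding of $(A,b)$, the circuit $F_{m,n,w}$ outputs an encoding, of length polynomial in $m,n,w$, of a matrix $A'\in\mathcal D$ (together with its dimensions $m'\times n'$) and a rational vector $b'$; 2. $Ax=b$ has a solution over $\mathbb R$ if and only if $A'x'=b'$ has a solution over $\mathbb R$; 3. given any encoding of bit length $\ell$ of any rational solution $x'$ of $A'x'=b'$, the circuit $R_{m,n,w,\ell}$ outputs an encoding, of length polynomial in $m,n,w,\ell$, of a rational solution $x$ of $Ax=b$. (The input of $R_{m,n,w,\ell}$ is $x'$ only, placed at the beginning of a buffer whose length $N(m,n,w)\ge n'$ depends only on $m,n,w$ and whose remaining entries are arbitrary.) **Lemma.** There are $\mathsf{TC}^0$-reductions between exact solvers (i) from $\mathcal G$ to $\mathcal G_z$; (ii) from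 $\mathcal G_z$ to $\mathcal G_{z,2}$; (iii) from $\mathcal G_{z,2}$ to $\mathcal{MC}_2$. -/

import Mathlib

namespace TC0Lin

/-! ### Threshold circuits -/

/-- A gate operation whose input wires are labelled by elements of `α`: negation, or `MAJORITY`
of arbitrary fan-in `k` (the same wire may be used several times, counted with multiplicity). -/
inductive GateOp (α : Type) : Type
  | not (a : α) : GateOp α
  | maj (k : ℕ) (a : Fin k → α) : GateOp α

namespace GateOp

/-- The set of wires that a gate reads. -/
def inputs {α : Type} : GateOp α → Set α
  | not a => {a}
  | maj _ a => Set.range a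

/-- The number of wires entering a gate, with multiplicity. -/
def fanIn {α : Type} : GateOp α → ℕ
  | not _ => 1
  | maj k _ => k

/-- The Boolean function of a gate: `MAJORITY` is true iff at least half of its inputs are. -/
def eval {α : Type} (v : α → Bool) : GateOp α → Bool
  | not a => !(v a)
  | maj k a => decide (k ≤ 2 * (Finset.univ.filter fun i => v (a i) = true).card)

theorem eval_congr {α : Type} {v v' : α → Bool} (o : GateOp α)
    (h : ∀ a ∈ o.inputs, v a = v' a) : o.eval v = o.eval v' := by
  cases o with
  | not a => simp [eval, h a (by simp [inputs])]
  | maj k a =>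
    have h2 : ∀ i, v (a i) = v' (a i) := fun i => h (a i) (by simp [inputs])
    simp [eval, h2]

end GateOp

/-- A circuit of unbounded fan-in `MAJORITY` and negation gates, with input wires `ι` and output
wires `κ`. The function `level` certifies acyclicity: a gate only reads circuit inputs
and gates of smaller level. -/
structure Circuit (ι κ : Type) : Type 1 where
  Gate : Type
  fintypeGate : Fintype Gate
  op : Gate → GateOp (ι ⊕ Gate)
  level : Gate → ℕ
  level_lt : ∀ g h : Gate, Sum.inr h ∈ (op g).inputs → level h < level g
  out : κ → ι ⊕ Gate

namespace Circuit

variable {ι κ : Type}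

open Classical in
/-- The value of a gate on input `x`, by recursion on the level. -/
noncomputable def gateVal (C : Circuit ι κ) (x : ι → Bool) (g : C.Gate) : Bool :=
  (C.op g).eval fun a =>
    match a with
    | Sum.inl i => x i
    | Sum.inr h => if _hh : Sum.inr h ∈ (C.op g).inputs then C.gateVal x h else false
termination_by C.level g
decreasing_by exact C.level_lt _ _ _hh

/-- Every gate has the value that its operation assigns to the values of the wires it reads. -/
theorem gateVal_eq (C : Circuit ι κ) (x : ι → Bool) (g : C.Gate) :
    C.gateVal x g = (C.op g).eval (Sum.elim x (C.gateVal x)) := by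
  rw [gateVal]
  apply GateOp.eval_congr
  rintro (i | h) ha
  · rfl
  · simp [ha]

/-- The function computed by a circuit. -/
noncomputable def eval (C : Circuit ι κ) (x : ι → Bool) : κ → Bool :=
  fun k => Sum.elim x (C.gateVal x) (C.out k)

/-- The number of gates plus the number of wires entering gates. -/
def size (C : Circuit ι κ) : ℕ :=
  letI := C.fintypeGate
  ∑ g : C.Gate, (1 + (C.op g).fanIn)

/-- The number of levels of gates; it bounds the number of gates on any path. -/
def depth (C : Circuit ι κ) : ℕ :=
  letI := C.fintypeGate
  Finset.univ.sup fun g : C.Gate => C.level g + 1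

end Circuit

/-- `f` is bounded by a polynomial in the size parameter `s`. -/
def PolyBounded {P : Type} (s : P → ℕ) (f : P → ℕ) : Prop :=
  ∃ c : ℕ, ∀ p, f p ≤ c * (s p + 1) ^ c

/-- A family of circuits is a `TC⁰` family, with respect to the size parameter `s`, if it has
bounded depth and size polynomial in `s`. -/
def IsTC0 {P : Type} (s : P → ℕ) {ι κ : P → Type} (C : ∀ p, Circuit (ι p) (κ p)) : Prop :=
  (∃ d : ℕ, ∀ p, (C p).depth ≤ d) ∧ PolyBounded s fun p => (C p).size

/-! ### Binary encodings -/

/-- The wires of a `w`-bit signed integer: a sign bit `none` and `w` bits of magnitude. -/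
abbrev IntWire (w : ℕ) : Type := Option (Fin w)

/-- The wires of a rational number: a `w`-bit signed numerator and a `w`-bit denominator. -/
abbrev RatWire (w : ℕ) : Type := IntWire w ⊕ Fin w

/-- The wires of a linear system `A x = b` with `m` equations and `n` unknowns. -/
abbrev SysWire (m n w : ℕ) : Type := (Fin m × Fin n × IntWire w) ⊕ (Fin m × RatWire w)

/-- The wires of a linear system with at most `M` equations and at most `N` unknowns: a buffer
for a system of size `M × N`, then the actual number of equations and of unknowns. -/
abbrev PadWire (M N w : ℕ) : Type := SysWire M N w ⊕ (Fin w ⊕ Fin w)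

/-- Value of a bit string in binary; bit `i` has weight `2 ^ i`. -/
def natVal {w : ℕ} (u : Fin w → Bool) : ℕ :=
  ∑ i, if u i = true then 2 ^ (i : ℕ) else 0

/-- Value of a bit string in sign-magnitude representation (sign bit true: negative). -/
def intVal {w : ℕ} (u : IntWire w → Bool) : ℤ :=
  (if u none = true then -1 else 1) * (natVal fun i => u (some i) : ℤ)

/-- `u` represents `q` as a fraction, not necessarily reduced, with nonzero denominator. -/
def EncodesRat {w : ℕ} (u : RatWire w → Bool) (q : ℚ) : Prop :=
  natVal (fun i => u (Sum.inr i)) ≠ 0 ∧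
    q = (intVal (fun t => u (Sum.inl t)) : ℚ) / (natVal (fun i => u (Sum.inr i)) : ℚ)

/-- `u` represents the linear system with matrix `A` and right-hand side `b`. -/
def EncodesSystem {m n w : ℕ} (u : SysWire m n w → Bool)
    (A : Matrix (Fin m) (Fin n) ℤ) (b : Fin m → ℚ) : Prop :=
  (∀ i j, intVal (fun t => u (Sum.inl (i, j, t))) = A i j) ∧
    ∀ i, EncodesRat (fun t => u (Sum.inr (i, t))) (b i)

/-- `u` represents the system `(A, b)` in the upper left corner of a buffer of size `M × N`,
together with the dimensions of `A` in binary; the rest of the buffer is ignored. -/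
def EncodesPadded {M N w m n : ℕ} (u : PadWire M N w → Bool)
    (A : Matrix (Fin m) (Fin n) ℤ) (b : Fin m → ℚ) : Prop :=
  natVal (fun i => u (Sum.inr (Sum.inl i))) = m ∧
  natVal (fun i => u (Sum.inr (Sum.inr i))) = n ∧
  ∃ (hm : m ≤ M) (hn : n ≤ N),
    (∀ i j, intVal (fun t => u (Sum.inl (Sum.inl (Fin.castLE hm i, Fin.castLE hn j, t)))) = A i j) ∧
    ∀ i, EncodesRat (fun t => u (Sum.inl (Sum.inr (Fin.castLE hm i, t)))) (b i)

/-- The first `n` entries of the buffer `u` of length `N` represent the vector `x`; the rest of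
the buffer is ignored. -/
def EncodesVec {N w n : ℕ} (u : Fin N × RatWire w → Bool) (x : Fin n → ℚ) : Prop :=
  ∃ hn : n ≤ N, ∀ j, EncodesRat (fun t => u (Fin.castLE hn j, t)) (x j)

/-! ### Classes of matrices -/

/-- A class of integer matrices. -/
abbrev MatrixClass : Type := ∀ m n : ℕ, Set (Matrix (Fin m) (Fin n) ℤ)

/-- Integer matrices without zero rows and zero columns. -/
def classG : MatrixClass := fun _ _ =>
  {A | (∀ i, ∃ j, A i j ≠ 0) ∧ ∀ j, ∃ i, A i j ≠ 0}

/-- Matrices in `classG` all of whose row sums are zero. -/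
def classGz : MatrixClass := fun m n =>
  {A | A ∈ classG m n ∧ ∀ i, ∑ j, A i j = 0}

/-- Matrices in `classGz` such that in every row the positive entries sum to a power of two. -/
def classGz2 : MatrixClass := fun m n =>
  {A | A ∈ classGz m n ∧ ∀ i, ∃ k : ℕ, ∑ j with 0 < A i j, A i j = 2 ^ k}

/-- The coefficient vector of the variable `x_i`, when the unknowns are
`x_1, …, x_k, y_1, …, y_k` in this order. -/
def xVar {k : ℕ} (i : Fin k) : Fin (k + k) → ℤ := Pi.single (Fin.castAdd k i) 1

/-- The coefficient vector of the variable `y_i`, when the unknowns are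
`x_1, …, x_k, y_1, …, y_k` in this order. -/
def yVar {k : ℕ} (i : Fin k) : Fin (k + k) → ℤ := Pi.single (Fin.natAdd k i) 1

/-- The coefficient vector of a nonzero scaling of `x_i - x_j`, of `y_i - y_j`, or of
`x_i - y_i - (x_j - y_j)`, for some `i ≠ j`. -/
def IsTwoCommodityRow {k : ℕ} (r : Fin (k + k) → ℤ) : Prop :=
  ∃ (c : ℤ) (i j : Fin k), c ≠ 0 ∧ i ≠ j ∧
    (r = c • (xVar i - xVar j) ∨ r = c • (yVar i - yVar j) ∨
      r = c • (xVar i - yVar i - (xVar j - yVar j)))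

/-- 2-commodity matrices (with integer coefficients). -/
def classMC2 : MatrixClass := fun _ n =>
  {A | ∃ (k : ℕ) (h : k + k = n), ∀ r, IsTwoCommodityRow fun t => A r (Fin.cast h t)}

/-! ### Reductions between exact solvers -/

/-- `x` solves the linear system `A x = b` over the field `K`. -/
def IsSol {m n : ℕ} (K : Type) [Field K] (A : Matrix (Fin m) (Fin n) ℤ) (b : Fin m → ℚ)
    (x : Fin n → K) : Prop :=
  ∀ i, ∑ j, (A i j : K) * x j = (b i : K)

/-- There is a `TC⁰`-reduction from exactly solving systems with matrix in `𝒞` to exactly solving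
systems with matrix in `𝒟`.

The circuit `F (m, n, w)` maps an `m × n` system `A x = b` of bit length `w` with `A` in `𝒞` to a
system `A' x' = b'` with `A'` in `𝒟`, solvable iff `A x = b` is. The circuit `R ((m, n, w), l)`
maps any rational solution `x'` of bit length `l` of the new system to a solution `x` of the
original one. -/
def TC0Reducible (𝒞 𝒟 : MatrixClass) : Prop :=
  ∃ (M N W : ℕ × ℕ × ℕ → ℕ) (L : (ℕ × ℕ × ℕ) × ℕ → ℕ)
    (F : ∀ p : ℕ × ℕ × ℕ, Circuit (SysWire p.1 p.2.1 p.2.2) (PadWire (M p) (N p) (W p)))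
    (R : ∀ q : (ℕ × ℕ × ℕ) × ℕ,
      Circuit (Fin (N q.1) × RatWire q.2) (Fin q.1.2.1 × RatWire (L q))),
    PolyBounded (fun p => p.1 + p.2.1 + p.2.2) M ∧
    PolyBounded (fun p => p.1 + p.2.1 + p.2.2) N ∧
    PolyBounded (fun p => p.1 + p.2.1 + p.2.2) W ∧
    PolyBounded (fun q => q.1.1 + q.1.2.1 + q.1.2.2 + q.2) L ∧
    IsTC0 (fun p => p.1 + p.2.1 + p.2.2) F ∧
    IsTC0 (fun q => q.1.1 + q.1.2.1 + q.1.2.2 + q.2) R ∧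
    ∀ (m n w : ℕ) (A : Matrix (Fin m) (Fin n) ℤ) (b : Fin m → ℚ) (u : SysWire m n w → Bool),
      A ∈ 𝒞 m n → EncodesSystem u A b →
      ∃ (m' n' : ℕ) (A' : Matrix (Fin m') (Fin n') ℤ) (b' : Fin m' → ℚ),
        A' ∈ 𝒟 m' n' ∧
        EncodesPadded ((F (m, n, w)).eval u) A' b' ∧
        ((∃ x : Fin n → ℝ, IsSol ℝ A b x) ↔ ∃ x' : Fin n' → ℝ, IsSol ℝ A' b' x') ∧
        ∀ (l : ℕ) (x' : Fin n' → ℚ) (v : Fin (N (m, n, w)) × RatWire l → Bool),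
          IsSol ℚ A' b' x' → EncodesVec v x' →
          ∃ x : Fin n → ℚ, EncodesVec ((R ((m, n, w), l)).eval v) x ∧ IsSol ℚ A b x

end TC0Lin

/-!
A single construction serves all three parts, because a 2-commodity row with coefficients `±1` has
row sum zero and its positive entries sum to `1` or `2`.

The left-hand side `A x` can be evaluated with additions alone: double every `x j` repeatedly, and
for every row add up the multiples `2 ^ t * x j` selected by the bits of the positive entries, and
separately those selected by the bits of the negative entries. The shape of this straight-line
program depends only on the dimensions; a zero bit of `A` merely replaces the second summand of an
addition by the constant zero. Each row of the system then prescribes the difference of two computed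
values.

An addition is expressed by 2-commodity equations as follows. Every node `v` satisfies
`x_v - x_0 = y_v - y_0`, where the vertex `0` stands for the constant zero. Given nodes `a` and `b`,
an auxiliary vertex copies `x` from `a` and `y` from `0`; a second one has the same difference
`x - y` and copies `y` from `b`, so that its `x` relative to `x_0` is the sum of the two values.
Solutions are determined only up to a common translation of both commodities, so the unknowns are
read off as differences `x_v - x_0`. An additional input, which no gate uses, keeps the columns of
the vertex `0` nonzero when there are no unknowns.

The entries of the new matrix are thus selected by single bits of the old one, and the only
arithmetic left to the circuits is the subtraction of two fractions, which needs sums and products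
of integers. Iterated sums are in `TC⁰` because a majority gate counts: cut the binary positions
into blocks of logarithmic length and treat the blocks of even and of odd index separately, so that
no carry travels beyond one block.
-/

namespace TC0Lin

open Finset

/-! ### Polynomial bounds -/

namespace PolyBounded

variable {P P' : Type} {s f g : P → ℕ}

theorem mono (h : PolyBounded s g) (hle : ∀ p, f p ≤ g p) : PolyBounded s f :=
  h.imp fun _ hc p => (hle p).trans (hc p)

theorem comp (h : PolyBounded s f) (e : P' → P) :
    PolyBounded (fun p => s (e p)) fun p => f (e p) :=
  h.imp fun _ hc p => hc (e p)

theorem const (s : P → ℕ) (c : ℕ) : PolyBounded s fun _ => c :=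
  ⟨c, fun p => Nat.le_mul_of_pos_right _ (by positivity)⟩

theorem of_le (h : ∀ p, f p ≤ s p) : PolyBounded s f :=
  ⟨1, fun p => by simpa only [one_mul, pow_one] using (h p).trans (Nat.le_succ _)⟩

theorem add (hf : PolyBounded s f) (hg : PolyBounded s g) : PolyBounded s fun p => f p + g p := by
  obtain ⟨a, ha⟩ := hf
  obtain ⟨b, hb⟩ := hg
  refine ⟨a + b, fun p => ?_⟩
  calc f p + g p ≤ a * (s p + 1) ^ a + b * (s p + 1) ^ b := add_le_add (ha p) (hb p)
    _ ≤ a * (s p + 1) ^ (a + b) + b * (s p + 1) ^ (a + b) := by gcongr <;> omega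
    _ = (a + b) * (s p + 1) ^ (a + b) := by ring

theorem mul (hf : PolyBounded s f) (hg : PolyBounded s g) : PolyBounded s fun p => f p * g p := by
  obtain ⟨a, ha⟩ := hf
  obtain ⟨b, hb⟩ := hg
  refine ⟨a * b + a + b, fun p => ?_⟩
  calc f p * g p ≤ (a * (s p + 1) ^ a) * (b * (s p + 1) ^ b) := Nat.mul_le_mul (ha p) (hb p)
    _ = (a * b) * (s p + 1) ^ (a + b) := by ring
    _ ≤ (a * b + a + b) * (s p + 1) ^ (a * b + a + b) := by gcongr <;> omega

end PolyBounded

/-! ### Building circuits -/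

namespace GateOp

variable {α β : Type}

/-- The gate operation with relabelled input wires. -/
def map (f : α → β) : GateOp α → GateOp β
  | not a => not (f a)
  | maj k a => maj k (f ∘ a)

theorem inputs_map (f : α → β) (o : GateOp α) : (o.map f).inputs = f '' o.inputs := by
  cases o with
  | not a => exact (Set.image_singleton).symm
  | maj k a => exact Set.range_comp f a

@[simp]
theorem fanIn_map (f : α → β) (o : GateOp α) : (o.map f).fanIn = o.fanIn := by
  cases o <;> rfl

theorem eval_map (f : α → β) (o : GateOp α) (v : β → Bool) :
    (o.map f).eval v = o.eval (v ∘ f) := by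
  cases o <;> rfl

theorem inr_mem_inputs_map {ι : Type} {e : α → β} {o : GateOp (ι ⊕ α)} {b : β} :
    Sum.inr b ∈ (o.map (Sum.map id e)).inputs ↔ ∃ a, Sum.inr a ∈ o.inputs ∧ e a = b := by
  simp [inputs_map]

end GateOp

namespace Circuit

variable {ι κ κ' J : Type}

theorem level_lt_depth (C : Circuit ι κ) (g : C.Gate) : C.level g < C.depth :=
  letI := C.fintypeGate
  Finset.le_sup (f := fun g : C.Gate => C.level g + 1) (Finset.mem_univ g)

theorem depth_le {C : Circuit ι κ} {d : ℕ} (h : ∀ g, C.level g < d) : C.depth ≤ d :=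
  letI := C.fintypeGate
  Finset.sup_le fun g _ => h g

theorem gateVal_of_embedding {C : Circuit ι κ} {D : Circuit ι κ'} (e : C.Gate → D.Gate)
    (h : ∀ g, D.op (e g) = (C.op g).map (Sum.map id e)) (x : ι → Bool) (g : C.Gate) :
    D.gateVal x (e g) = C.gateVal x g := by
  induction hn : C.level g using Nat.strong_induction_on generalizing g with
  | _ n ih =>
    rw [gateVal_eq, gateVal_eq, h, GateOp.eval_map]
    refine GateOp.eval_congr _ ?_
    rintro (i | g') hg'
    · rfl
    · exact ih _ (hn ▸ C.level_lt _ _ hg') g' rfl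

/-- The circuit without gates whose output wires are input wires. -/
def wires (f : κ → ι) : Circuit ι κ where
  Gate := Empty
  fintypeGate := inferInstance
  op := Empty.elim
  level := Empty.elim
  level_lt := fun g => g.elim
  out := Sum.inl ∘ f

/-- Circuits with common inputs and one output each, side by side. -/
def parallel [Fintype J] (C : J → Circuit ι Unit) : Circuit ι J where
  Gate := Σ j, (C j).Gate
  fintypeGate := letI := fun j => (C j).fintypeGate; inferInstance
  op := fun g => ((C g.1).op g.2).map (Sum.map id (Sigma.mk g.1))
  level := fun g => (C g.1).level g.2
  level_lt := by
    rintro ⟨j, g⟩ _ h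
    obtain ⟨g', hg', rfl⟩ := GateOp.inr_mem_inputs_map.1 h
    exact (C j).level_lt _ _ hg'
  out := fun j => Sum.map id (Sigma.mk j) ((C j).out ())

theorem eval_parallel [Fintype J] (C : J → Circuit ι Unit) (x : ι → Bool) (j : J) :
    (parallel C).eval x j = (C j).eval x () := by
  simp only [eval, parallel]
  cases (C j).out () with
  | inl i => rfl
  | inr g => exact gateVal_of_embedding (D := parallel C) (fun g => ⟨j, g⟩) (fun _ => rfl) x g

theorem size_parallel [Fintype J] (C : J → Circuit ι Unit) :
    (parallel C).size = ∑ j, (C j).size := by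
  let := fun j => (C j).fintypeGate
  refine (Finset.sum_congr rfl fun g _ => ?_).trans
    (Fintype.sum_sigma fun g : Σ j, (C j).Gate => 1 + ((C g.1).op g.2).fanIn)
  exact congrArg (1 + ·) (GateOp.fanIn_map _ _)

theorem depth_parallel_le [Fintype J] {C : J → Circuit ι Unit} {d : ℕ}
    (h : ∀ j, (C j).depth ≤ d) : (parallel C).depth ≤ d :=
  depth_le fun g => ((C g.1).level_lt_depth g.2).trans_le (h g.1)

/-- The circuit extended by one gate, which reads output wires and computes the new output. -/
def addGate (C : Circuit ι κ) (o : GateOp κ) : Circuit ι Unit where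
  Gate := Option C.Gate
  fintypeGate := letI := C.fintypeGate; inferInstance
  op := fun g => g.elim ((o.map C.out).map (Sum.map id some)) fun g =>
    (C.op g).map (Sum.map id some)
  level := fun g => g.elim C.depth C.level
  level_lt := by
    rintro (_ | g) _ h <;> obtain ⟨g', hg', rfl⟩ := GateOp.inr_mem_inputs_map.1 h
    · exact C.level_lt_depth g'
    · exact C.level_lt _ _ hg'
  out := fun _ => Sum.inr none

theorem eval_addGate (C : Circuit ι κ) (o : GateOp κ) (x : ι → Bool) :
    (C.addGate o).eval x () = o.eval (C.eval x) := by
  refine (gateVal_eq (C.addGate o) x none).trans ?_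
  refine (GateOp.eval_map _ _ _).trans ((GateOp.eval_map _ _ _).trans ?_)
  refine GateOp.eval_congr _ fun k _ => ?_
  simp only [eval, Function.comp_apply]
  cases C.out k with
  | inl i => rfl
  | inr g => exact gateVal_of_embedding (D := C.addGate o) some (fun _ => rfl) x g

theorem size_addGate (C : Circuit ι κ) (o : GateOp κ) :
    (C.addGate o).size = 1 + o.fanIn + C.size := by
  let := C.fintypeGate
  refine (Fintype.sum_option _).trans ?_
  simp [addGate, size]

theorem depth_addGate_le (C : Circuit ι κ) (o : GateOp κ) :
    (C.addGate o).depth ≤ C.depth + 1 := by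
  refine depth_le ?_
  rintro (_ | g)
  · exact Nat.lt_succ_self _
  · exact (C.level_lt_depth g).trans (Nat.lt_succ_self _)

end Circuit

namespace IsTC0

variable {Q : Type} {s : Q → ℕ} {ι κ J : Q → Type}

theorem parallel [∀ q, Fintype (J q)] (hJ : PolyBounded s fun q => Fintype.card (J q))
    {C : ∀ a : Σ q, J q, Circuit (ι a.1) Unit} (h : IsTC0 (fun a : Σ q, J q => s a.1) C) :
    IsTC0 s fun q => Circuit.parallel fun j => C ⟨q, j⟩ := by
  obtain ⟨⟨d, hd⟩, c, hc⟩ := h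
  refine ⟨⟨d, fun q => Circuit.depth_parallel_le fun j => hd ⟨q, j⟩⟩,
    (hJ.mul ⟨c, fun q => le_rfl⟩).mono fun q => ?_⟩
  rw [Circuit.size_parallel, ← smul_eq_mul, ← Finset.card_univ]
  exact Finset.sum_le_card_nsmul _ _ _ fun j _ => hc ⟨q, j⟩

theorem addGate {C : ∀ q, Circuit (ι q) (κ q)} (h : IsTC0 s C) (o : ∀ q, GateOp (κ q))
    (ho : PolyBounded s fun q => (o q).fanIn) : IsTC0 s fun q => (C q).addGate (o q) := by
  obtain ⟨⟨d, hd⟩, hsize⟩ := h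
  refine ⟨⟨d + 1, fun q => (Circuit.depth_addGate_le _ _).trans (Nat.succ_le_succ (hd q))⟩,
    (((PolyBounded.const s 1).add ho).add hsize).mono fun q => (Circuit.size_addGate _ _).le⟩

end IsTC0

/-! ### Predicates decided by threshold circuits -/

/-- A family of predicates on bit strings that is decided by a `TC⁰` family of circuits with one
output. Whatever else a predicate depends on is part of the index `q`. -/
def TC0Pred {Q : Type} (s : Q → ℕ) {ι : Q → Type} (f : ∀ q, (ι q → Bool) → Prop) : Prop :=
  ∃ C : ∀ q, Circuit (ι q) Unit, IsTC0 s C ∧ ∀ q x, (C q).eval x () = true ↔ f q x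

namespace TC0Pred

variable {Q Q₁ Q₂ : Type} {s : Q → ℕ} {ι : Q → Type} {f g : ∀ q, (ι q → Bool) → Prop}

theorem comp (h : TC0Pred s f) (e : Q₁ → Q) :
    TC0Pred (fun a => s (e a)) fun a => f (e a) :=
  let ⟨C, ⟨⟨d, hd⟩, hsize⟩, hC⟩ := h
  ⟨fun a => C (e a), ⟨⟨d, fun a => hd (e a)⟩, hsize.comp e⟩, fun a => hC (e a)⟩

theorem congr (h : TC0Pred s f) (hfg : ∀ q x, g q x ↔ f q x) : TC0Pred s g := by
  rwa [show g = f from funext₂ fun q x => propext (hfg q x)]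

theorem iff_forall_exists : TC0Pred s f ↔ ∃ c : ℕ, ∀ q, ∃ C : Circuit (ι q) Unit,
    C.depth ≤ c ∧ C.size ≤ c * (s q + 1) ^ c ∧ ∀ x, C.eval x () = true ↔ f q x := by
  constructor
  · rintro ⟨C, ⟨⟨d, hd⟩, c, hc⟩, hC⟩
    refine ⟨d + c, fun q => ⟨C q, (hd q).trans (by omega), (hc q).trans ?_, hC q⟩⟩
    gcongr <;> omega
  · rintro ⟨c, h⟩
    choose C hd hs hC using h
    exact ⟨C, ⟨⟨c, hd⟩, c, hs⟩, hC⟩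

theorem of_cover (e₁ : Q₁ → Q) (e₂ : Q₂ → Q) (he : ∀ q, (∃ a, e₁ a = q) ∨ ∃ a, e₂ a = q)
    (h₁ : TC0Pred (fun a => s (e₁ a)) fun a => f (e₁ a))
    (h₂ : TC0Pred (fun a => s (e₂ a)) fun a => f (e₂ a)) : TC0Pred s f := by
  obtain ⟨c₁, h₁⟩ := iff_forall_exists.1 h₁
  obtain ⟨c₂, h₂⟩ := iff_forall_exists.1 h₂
  refine iff_forall_exists.2 ⟨c₁ + c₂, fun q => ?_⟩
  obtain ⟨a, rfl⟩ | ⟨a, rfl⟩ := he q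
  · obtain ⟨C, hd, hs, hC⟩ := h₁ a
    refine ⟨C, hd.trans (by omega), hs.trans ?_, hC⟩
    gcongr <;> omega
  · obtain ⟨C, hd, hs, hC⟩ := h₂ a
    refine ⟨C, hd.trans (by omega), hs.trans ?_, hC⟩
    gcongr <;> omega

theorem var (i : ∀ q, ι q) : TC0Pred s fun q (x : ι q → Bool) => x (i q) = true := by
  refine ⟨fun q => Circuit.wires fun _ => i q,
    ⟨⟨0, fun q => Circuit.depth_le fun g => g.elim⟩, (PolyBounded.const s 0).mono fun q => ?_⟩,
    fun q x => Iff.rfl⟩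
  exact (Finset.sum_of_isEmpty (ι := Empty) _).le

protected theorem not (h : TC0Pred s f) : TC0Pred s fun q x => ¬ f q x := by
  obtain ⟨C, hC, hf⟩ := h
  refine ⟨_, hC.addGate (fun _ => .not ()) (PolyBounded.const s 1), fun q x => ?_⟩
  simp [Circuit.eval_addGate, GateOp.eval, ← hf]

section counting

variable {J : Q → Type} [∀ q, Fintype (J q)] {f : ∀ q, J q → (ι q → Bool) → Prop}

open Classical in
theorem majority (hJ : PolyBounded s fun q => Fintype.card (J q))
    (h : TC0Pred (fun a : Σ q, J q => s a.1) fun a => f a.1 a.2) :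
    TC0Pred s fun q x => Fintype.card (J q) ≤ 2 * #{j | f q j x} := by
  obtain ⟨C, hC, hf⟩ := h
  refine ⟨_, (hC.parallel hJ).addGate
    (fun q => .maj (Fintype.card (J q)) (Fintype.equivFin (J q)).symm) hJ, fun q x => ?_⟩
  rw [Circuit.eval_addGate]
  simp only [GateOp.eval, Circuit.eval_parallel, decide_eq_true_eq, hf ⟨q, _⟩]
  have hcard : #{k | f q ((Fintype.equivFin (J q)).symm k) x} = #{j | f q j x} :=
    card_equiv (Fintype.equivFin (J q)).symm (by simp)
  rw [← hcard]

protected theorem true : TC0Pred s fun q (_ : ι q → Bool) => True := by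
  refine (majority (J := fun _ => Empty) (f := fun _ _ _ => False) (PolyBounded.const s 0)
    ⟨fun a => a.2.elim, ⟨⟨0, fun a => a.2.elim⟩, 0, fun a => a.2.elim⟩, fun a => a.2.elim⟩).congr
    fun q _ => ?_
  simp

protected theorem false : TC0Pred s fun q (_ : ι q → Bool) => False := by
  simpa only [not_true_eq_false] using (TC0Pred.true (s := s) (ι := ι)).not

protected theorem const (P : Q → Prop) : TC0Pred s fun q (_ : ι q → Bool) => P q :=
  of_cover (Subtype.val : {q // P q} → Q) (Subtype.val : {q // ¬ P q} → Q)
    (fun q => (em (P q)).imp (fun h => ⟨⟨q, h⟩, rfl⟩) fun h => ⟨⟨q, h⟩, rfl⟩)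
    (TC0Pred.true.congr fun q _ => iff_true_intro q.2)
    (TC0Pred.false.congr fun q _ => iff_false_intro q.2)

theorem sumElim {J K : Q → Type} {f : ∀ q, J q → (ι q → Bool) → Prop}
    {g : ∀ q, K q → (ι q → Bool) → Prop}
    (hf : TC0Pred (fun a : Σ q, J q => s a.1) fun a => f a.1 a.2)
    (hg : TC0Pred (fun a : Σ q, K q => s a.1) fun a => g a.1 a.2) :
    TC0Pred (fun a : Σ q, J q ⊕ K q => s a.1) fun a => Sum.elim (f a.1) (g a.1) a.2 :=
  of_cover (fun a : Σ q, J q => ⟨a.1, Sum.inl a.2⟩) (fun a : Σ q, K q => ⟨a.1, Sum.inr a.2⟩)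
    (fun | ⟨q, .inl j⟩ => .inl ⟨⟨q, j⟩, rfl⟩ | ⟨q, .inr k⟩ => .inr ⟨⟨q, k⟩, rfl⟩) hf hg

open Classical in
theorem le_card (hJ : PolyBounded s fun q => Fintype.card (J q))
    (h : TC0Pred (fun a : Σ q, J q => s a.1) fun a => f a.1 a.2) (v : Q → ℕ) :
    TC0Pred s fun q x => v q ≤ #{j | f q j x} := by
  let v' := fun q => min (v q) (Fintype.card (J q) + 1)
  have hv' : PolyBounded s v' := (hJ.add (.const s 1)).mono fun q => min_le_right _ _
  -- A majority vote padded by `card (J q)` true and `2 * v' q` false inputs.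
  let pad : ∀ q, J q ⊕ Fin (2 * v' q) → (ι q → Bool) → Prop := fun q =>
    Sum.elim (fun _ _ => True) fun _ _ => False
  let f' : ∀ q, J q ⊕ J q ⊕ Fin (2 * v' q) → (ι q → Bool) → Prop := fun q =>
    Sum.elim (f q) (pad q)
  have hf' : TC0Pred (fun a : Σ q, J q ⊕ J q ⊕ Fin (2 * v' q) => s a.1) fun a => f' a.1 a.2 :=
    sumElim (g := pad) h (sumElim (f := fun _ _ _ => True) (g := fun _ _ _ => False) .true .false)
  refine (majority (f := f')
    ((hJ.add (hJ.add ((PolyBounded.const s 2).mul hv'))).mono fun q => by simp) hf').congr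
    fun q x => ?_
  have hle : #{j | f q j x} ≤ Fintype.card (J q) := card_filter_le _ _
  have hpad : #{j | f' q j x} = #{j | f q j x} + Fintype.card (J q) := by
    rw [card_filter, Fintype.sum_sum_type, Fintype.sum_sum_type, card_filter]
    exact congrArg _ (by simp [f', pad])
  rw [hpad]
  simp only [Fintype.card_sum, Fintype.card_fin, v']
  omega

theorem exists_fintype (hJ : PolyBounded s fun q => Fintype.card (J q))
    (h : TC0Pred (fun a : Σ q, J q => s a.1) fun a => f a.1 a.2) :
    TC0Pred s fun q x => ∃ j, f q j x := by
  refine (le_card hJ h fun _ => 1).congr fun q x => ?_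
  simp [Nat.one_le_iff_ne_zero, filter_eq_empty_iff]

end counting

theorem exists_lt {n : Q → ℕ} {f : ∀ q, ℕ → (ι q → Bool) → Prop} (hn : PolyBounded s n)
    (h : TC0Pred (fun a : Q × ℕ => s a.1) fun a => f a.1 a.2) :
    TC0Pred s fun q x => ∃ j < n q, f q j x :=
  (exists_fintype (J := fun q => Fin (n q)) (f := fun q j => f q j) (hn.mono fun q => by simp)
    (h.comp fun a : Σ q, Fin (n q) => (a.1, a.2))).congr fun q x => by simp [Fin.exists_iff]

theorem forall_lt {n : Q → ℕ} {f : ∀ q, ℕ → (ι q → Bool) → Prop} (hn : PolyBounded s n)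
    (h : TC0Pred (fun a : Q × ℕ => s a.1) fun a => f a.1 a.2) :
    TC0Pred s fun q x => ∀ j < n q, f q j x :=
  (exists_lt (f := fun q j x => ¬ f q j x) hn h.not).not.congr fun q x => by simp

protected theorem or (hf : TC0Pred s f) (hg : TC0Pred s g) :
    TC0Pred s fun q x => f q x ∨ g q x := by
  refine (exists_fintype (J := fun _ => Unit ⊕ Unit)
    (f := fun q => Sum.elim (fun _ => f q) fun _ => g q) (.const s 2)
    (sumElim (f := fun q _ => f q) (g := fun q _ => g q) (hf.comp Sigma.fst)
      (hg.comp Sigma.fst))).congr fun q x => ?_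
  simp

protected theorem and (hf : TC0Pred s f) (hg : TC0Pred s g) :
    TC0Pred s fun q x => f q x ∧ g q x :=
  (hf.not.or hg.not).not.congr fun q x => by tauto

protected theorem imp (hf : TC0Pred s f) (hg : TC0Pred s g) :
    TC0Pred s fun q x => f q x → g q x :=
  (hf.not.or hg).congr fun _ _ => imp_iff_not_or

protected theorem iff (hf : TC0Pred s f) (hg : TC0Pred s g) :
    TC0Pred s fun q x => (f q x ↔ g q x) :=
  ((hf.imp hg).and (hg.imp hf)).congr fun _ _ => iff_iff_implies_and_implies

protected theorem ite {p : ∀ q, (ι q → Bool) → Prop} [∀ q x, Decidable (p q x)]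
    (hp : TC0Pred s p) (hf : TC0Pred s f) (hg : TC0Pred s g) :
    TC0Pred s fun q x => if p q x then f q x else g q x :=
  ((hp.imp hf).and (hp.not.imp hg)).congr fun q x => by split_ifs <;> simp [*]

section counting

variable {J : Q → Type} [∀ q, Fintype (J q)] {f : ∀ q, J q → (ι q → Bool) → Prop}

open Classical in
protected theorem card (hJ : PolyBounded s fun q => Fintype.card (J q))
    (h : TC0Pred (fun a : Σ q, J q => s a.1) fun a => f a.1 a.2) (R : Q → ℕ → Prop) :
    TC0Pred s fun q x => R q #{j | f q j x} := by
  have hle : ∀ v : Q × ℕ → ℕ, TC0Pred (fun a : Q × ℕ => s a.1) fun a x =>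
      v a ≤ #{j | f a.1 j x} :=
    le_card (J := fun a : Q × ℕ => J a.1) (f := fun a => f a.1) (hJ.comp Prod.fst)
      (h.comp fun a : Σ a : Q × ℕ, J a.1 => ⟨a.1.1, a.2⟩)
  have heq : TC0Pred s fun q x => ∃ c < Fintype.card (J q) + 1,
      R q c ∧ c ≤ #{j | f q j x} ∧ ¬ c + 1 ≤ #{j | f q j x} :=
    exists_lt (hJ.add (.const s 1)) ((TC0Pred.const fun a => R a.1 a.2).and
      ((hle fun a => a.2).and (hle fun a => a.2 + 1).not))
  refine heq.congr fun q x => ⟨fun hR => ?_, ?_⟩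
  · exact ⟨_, Nat.lt_succ_of_le (card_filter_le _ _), hR, le_rfl, by simp⟩
  · rintro ⟨c, -, hR, hc, hc'⟩
    rwa [show #{j | f q j x} = c by omega]

open Classical in
protected theorem sum {a : ∀ q, J q → ℕ} (ha : PolyBounded s fun q => ∑ j, a q j)
    (h : TC0Pred (fun a : Σ q, J q => s a.1) fun a => f a.1 a.2) (R : Q → ℕ → Prop) :
    TC0Pred s fun q x => R q (∑ j with f q j x, a q j) := by
  refine (TC0Pred.card (J := fun q => Σ j, Fin (a q j)) (f := fun q k => f q k.1)
    (by simpa using ha)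
    (h.comp fun k : Σ q, Σ j, Fin (a q j) => ⟨k.1, k.2.1⟩) R).congr fun q x => ?_
  have hcard : #{k : Σ j, Fin (a q j) | f q k.1 x} = ∑ j with f q j x, a q j := by
    simp only [card_filter, Fintype.sum_sigma, sum_filter]
    exact sum_congr rfl fun j _ => by split_ifs <;> simp
  rw [hcard]

end counting

theorem exists_circuit {κ : Q → Type} [∀ q, Fintype (κ q)]
    (hκ : PolyBounded s fun q => Fintype.card (κ q)) {g : ∀ q, (ι q → Bool) → κ q → Bool}
    (h : TC0Pred (fun a : Σ q, κ q => s a.1) fun a x => g a.1 x a.2 = true) :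
    ∃ C : ∀ q, Circuit (ι q) (κ q), IsTC0 s C ∧ ∀ q x, (C q).eval x = g q x := by
  obtain ⟨C, hC, hg⟩ := h
  refine ⟨_, hC.parallel hκ, fun q x => funext fun k => ?_⟩
  rw [Circuit.eval_parallel, Bool.eq_iff_iff]
  exact hg ⟨q, k⟩ x

end TC0Pred

/-! ### Binary representations of sums -/

theorem natVal_eq_ofBits {w : ℕ} (u : Fin w → Bool) : natVal u = Nat.ofBits u := by
  induction w with
  | zero => rfl
  | succ w ih =>
    rw [Nat.ofBits_succ, ← ih, natVal, Fin.sum_univ_succ, natVal, mul_sum, add_comm]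
    congr 1
    · exact sum_congr rfl fun i _ => by simp [pow_succ']
    · cases u 0 <;> simp

theorem natVal_lt {w : ℕ} (u : Fin w → Bool) : natVal u < 2 ^ w :=
  natVal_eq_ofBits u ▸ Nat.ofBits_lt_two_pow u

theorem testBit_natVal {w : ℕ} (u : Fin w → Bool) (t : ℕ) :
    (natVal u).testBit t = if h : t < w then u ⟨t, h⟩ else false := by
  rw [natVal_eq_ofBits, Nat.testBit_ofBits]

theorem natVal_testBit {w a : ℕ} (h : a < 2 ^ w) : natVal (fun t : Fin w => a.testBit t) = a := by
  refine Nat.eq_of_testBit_eq fun t => ?_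
  rw [testBit_natVal]
  split_ifs with ht
  · rfl
  · exact (Nat.testBit_lt_two_pow (h.trans_le (Nat.pow_le_pow_right two_pos (not_lt.1 ht)))).symm

/-- Adding `a` and `b` in binary produces a carry into position `t`. -/
def HasCarry (a b t : ℕ) : Prop :=
  2 ^ t ≤ a % 2 ^ t + b % 2 ^ t

theorem hasCarry_succ (a b t : ℕ) : HasCarry a b (t + 1) ↔
    (a.testBit t = true ∧ b.testBit t = true) ∨
      ((a.testBit t = true ∨ b.testBit t = true) ∧ HasCarry a b t) := by
  have ha := Nat.mod_lt a (Nat.two_pow_pos t)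
  have hb := Nat.mod_lt b (Nat.two_pow_pos t)
  rw [HasCarry, HasCarry, Nat.mod_pow_succ, Nat.mod_pow_succ, pow_succ]
  simp only [Nat.testBit_eq_decide_div_mod_eq, decide_eq_true_eq]
  obtain h | h := Nat.mod_two_eq_zero_or_one (a / 2 ^ t) <;>
    obtain h' | h' := Nat.mod_two_eq_zero_or_one (b / 2 ^ t) <;> grind

theorem hasCarry_iff (a b t : ℕ) : HasCarry a b t ↔
    ∃ j < t, (a.testBit j = true ∧ b.testBit j = true) ∧
      ∀ l < t, j < l → a.testBit l = true ∨ b.testBit l = true := by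
  induction t with
  | zero => simp [HasCarry, Nat.mod_one]
  | succ t ih =>
    rw [hasCarry_succ, ih]
    constructor
    · rintro (hab | ⟨hab, j, hj, hj', hl⟩)
      · exact ⟨t, t.lt_succ_self, hab, fun l _ _ => by omega⟩
      · refine ⟨j, by omega, hj', fun l hlt hjl => ?_⟩
        obtain hlt | rfl := Nat.lt_succ_iff_lt_or_eq.1 hlt
        exacts [hl l hlt hjl, hab]
    · rintro ⟨j, hj, hj', hl⟩
      obtain hj | rfl := Nat.lt_succ_iff_lt_or_eq.1 hj
      · exact .inr ⟨hl t t.lt_succ_self hj, j, hj, hj', fun l hlt => hl l (by omega)⟩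
      · exact .inl hj'

theorem testBit_add_iff (a b t : ℕ) : (a + b).testBit t = true ↔
    ((a.testBit t = true ↔ b.testBit t = true) ↔ HasCarry a b t) := by
  simp only [HasCarry, Nat.testBit_eq_decide_div_mod_eq, Nat.add_div (Nat.two_pow_pos t),
    decide_eq_true_eq]
  split_ifs with hc <;> simp only [hc, iff_true, iff_false] <;> omega

theorem testBit_sum_two_pow_mul {L N : ℕ} {D : ℕ → ℕ} (hD : ∀ v, D v < 2 ^ L) (t : ℕ)
    (ht : t < L * N) :
    (∑ v ∈ range N, 2 ^ (L * v) * D v).testBit t = (D (t / L)).testBit (t % L) := by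
  induction N generalizing D t with
  | zero => simp at ht
  | succ N ih =>
    have hL : 0 < L := Nat.pos_of_mul_pos_right (Nat.zero_lt_of_lt ht)
    have hpeel : ∑ v ∈ range (N + 1), 2 ^ (L * v) * D v =
        2 ^ L * (∑ v ∈ range N, 2 ^ (L * v) * D (v + 1)) + D 0 := by
      rw [sum_range_succ', mul_sum]
      simp [mul_add, pow_add, mul_comm, mul_left_comm]
    rw [hpeel, Nat.testBit_two_pow_mul_add _ (hD 0)]
    split_ifs with htL
    · rw [Nat.div_eq_of_lt htL, Nat.mod_eq_of_lt htL]
    · have hLt : L ≤ t := not_lt.1 htL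
      rw [ih (fun v => hD (v + 1)) (t - L) (by rw [mul_add] at ht; omega),
        ← Nat.mod_eq_sub_mod hLt, ← Nat.add_div_right _ hL, Nat.sub_add_cancel hLt]

theorem testBit_sum_two_pow_blocks {J : Type} (S : Finset J) {L : ℕ} (hL : 0 < L) (u r : J → ℕ)
    (hS : ∀ v, ∑ j ∈ S with u j = v, 2 ^ r j < 2 ^ L) (t : ℕ) :
    (∑ j ∈ S, 2 ^ (L * u j + r j)).testBit t =
      (∑ j ∈ S with u j = t / L, 2 ^ r j).testBit (t % L) := by
  have hu : ∀ j ∈ S, u j ∈ range (S.sup u + t + 1) := fun j hj => by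
    have := le_sup (f := u) hj
    simp only [mem_range]
    omega
  have ht : t < L * (S.sup u + t + 1) :=
    (by omega : t < S.sup u + t + 1).trans_le (Nat.le_mul_of_pos_left _ hL)
  rw [← testBit_sum_two_pow_mul hS t ht, ← sum_fiberwise_of_maps_to hu]
  congr 1
  refine sum_congr rfl fun v _ => ?_
  rw [mul_sum]
  refine sum_congr rfl fun j hj => ?_
  rw [(mem_filter.1 hj).2, pow_add]

/-! ### Arithmetic of natural numbers -/

namespace PolyBounded

variable {P P' : Type} {s f : P → ℕ}

theorem exists_bound_comp {e : P' → P} {f : P' → ℕ} (h : PolyBounded (fun p => s (e p)) f) :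
    ∃ g, PolyBounded s g ∧ ∀ p, f p ≤ g (e p) :=
  let ⟨c, hc⟩ := h
  ⟨fun p => c * (s p + 1) ^ c, ⟨c, fun _ => le_rfl⟩, hc⟩

theorem two_pow_log_succ (h : PolyBounded s f) :
    PolyBounded s fun p => 2 ^ (Nat.log 2 (f p) + 1) := by
  refine (((PolyBounded.const s 2).mul h).add (.const s 2)).mono fun p => ?_
  obtain hf | hf := eq_or_ne (f p) 0
  · simp [hf]
  · have := Nat.pow_log_le_self 2 hf
    rw [pow_succ]
    omega

end PolyBounded

/-- A family of natural numbers, depending on bit strings, with polynomially many binary digits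
that are computed by a `TC⁰` family of circuits. -/
structure TC0Nat {Q : Type} (s : Q → ℕ) {ι : Q → Type} (a : ∀ q, (ι q → Bool) → ℕ) : Prop where
  exists_lt : ∃ W, PolyBounded s W ∧ ∀ q x, a q x < 2 ^ W q
  testBit : TC0Pred (fun k : Q × ℕ => s k.1) fun k x => (a k.1 x).testBit k.2 = true

namespace TC0Nat

variable {Q Q₁ : Type} {s : Q → ℕ} {ι : Q → Type} {a b : ∀ q, (ι q → Bool) → ℕ}

theorem comp (ha : TC0Nat s a) (e : Q₁ → Q) : TC0Nat (fun q => s (e q)) fun q => a (e q) :=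
  let ⟨_, hW, hlt⟩ := ha.exists_lt
  ⟨⟨_, hW.comp e, fun q => hlt (e q)⟩, ha.testBit.comp fun k : Q₁ × ℕ => (e k.1, k.2)⟩

theorem congr (ha : TC0Nat s a) (hab : ∀ q x, b q x = a q x) : TC0Nat s b := by
  rwa [funext₂ hab]

theorem exists_lt₂ (ha : TC0Nat s a) (hb : TC0Nat s b) :
    ∃ W, PolyBounded s W ∧ ∀ q x, a q x < 2 ^ W q ∧ b q x < 2 ^ W q := by
  obtain ⟨V, hV, ha⟩ := ha.exists_lt
  obtain ⟨W, hW, hb⟩ := hb.exists_lt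
  refine ⟨_, hV.add hW, fun q x => ⟨(ha q x).trans_le ?_, (hb q x).trans_le ?_⟩⟩ <;>
    exact Nat.pow_le_pow_right two_pos (by omega)

theorem exists_lt_comp {e : Q₁ → Q} {ι : Q₁ → Type} {a : ∀ q, (ι q → Bool) → ℕ}
    (ha : TC0Nat (fun q => s (e q)) a) : ∃ W, PolyBounded s W ∧ ∀ q x, a q x < 2 ^ W (e q) := by
  obtain ⟨W, hW, hlt⟩ := ha.exists_lt
  obtain ⟨W', hW', hle⟩ := hW.exists_bound_comp
  exact ⟨W', hW', fun q x => (hlt q x).trans_le (Nat.pow_le_pow_right two_pos (hle q))⟩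

theorem of_testBit_lt {W : Q → ℕ} (hW : PolyBounded s W) (hlt : ∀ q x, a q x < 2 ^ W q)
    (h : TC0Pred (fun k : Σ q, Fin (W q) => s k.1) fun k x => (a k.1 x).testBit k.2 = true) :
    TC0Nat s a := by
  refine ⟨⟨W, hW, hlt⟩, (TC0Pred.exists_fintype (J := fun k : Q × ℕ => Fin (W k.1))
    (f := fun k i x => k.2 = i ∧ (a k.1 x).testBit i = true)
    ((hW.comp Prod.fst).mono fun k => (Fintype.card_fin _).le)
    ((TC0Pred.const fun k : Σ k : Q × ℕ, Fin (W k.1) => k.1.2 = k.2).and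
      (h.comp fun k : Σ k : Q × ℕ, Fin (W k.1) => ⟨k.1.1, k.2⟩))).congr fun k x => ?_⟩
  constructor
  · intro hk
    exact ⟨⟨k.2, lt_of_not_ge fun hle => by
      simp [Nat.testBit_lt_two_pow ((hlt k.1 x).trans_le (Nat.pow_le_pow_right two_pos hle))]
        at hk⟩, rfl, hk⟩
  · rintro ⟨i, hi, hbit⟩
    rwa [hi]

theorem const {c : Q → ℕ} (hc : PolyBounded s c) : TC0Nat s fun q (_ : ι q → Bool) => c q :=
  ⟨⟨c, hc, fun _ _ => Nat.lt_two_pow_self⟩,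
    .const fun k : Q × ℕ => (c k.1).testBit k.2 = true⟩

theorem of_wires {w : Q → ℕ} (hw : PolyBounded s w) (e : ∀ q, Fin (w q) → ι q) :
    TC0Nat s fun q (x : ι q → Bool) => natVal fun t => x (e q t) :=
  of_testBit_lt hw (fun _ _ => natVal_lt _) <|
    (TC0Pred.var fun k : Σ q, Fin (w q) => e k.1 k.2).congr fun k x => by
      rw [testBit_natVal, dif_pos k.2.2]

theorem sumElim {J K : Q → Type} {a : ∀ q, J q → (ι q → Bool) → ℕ}
    {b : ∀ q, K q → (ι q → Bool) → ℕ}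
    (ha : TC0Nat (fun k : Σ q, J q => s k.1) fun k => a k.1 k.2)
    (hb : TC0Nat (fun k : Σ q, K q => s k.1) fun k => b k.1 k.2) :
    TC0Nat (fun k : Σ q, J q ⊕ K q => s k.1) fun k => Sum.elim (a k.1) (b k.1) k.2 := by
  obtain ⟨V, hV, hltV⟩ := ha.exists_lt_comp
  obtain ⟨W, hW, hltW⟩ := hb.exists_lt_comp
  constructor
  · refine ⟨_, (hV.add hW).comp Sigma.fst, ?_⟩
    rintro ⟨q, j | k⟩ x
    · exact (hltV ⟨q, j⟩ x).trans_le (Nat.pow_le_pow_right two_pos (Nat.le_add_right _ _))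
    · exact (hltW ⟨q, k⟩ x).trans_le (Nat.pow_le_pow_right two_pos (Nat.le_add_left _ _))
  · exact .of_cover (fun k : (Σ q, J q) × ℕ => (⟨k.1.1, .inl k.1.2⟩, k.2))
      (fun k : (Σ q, K q) × ℕ => (⟨k.1.1, .inr k.1.2⟩, k.2))
      (fun | (⟨q, .inl j⟩, t) => .inl ⟨(⟨q, j⟩, t), rfl⟩
           | (⟨q, .inr j⟩, t) => .inr ⟨(⟨q, j⟩, t), rfl⟩) ha.testBit hb.testBit

theorem ite {p : ∀ q, (ι q → Bool) → Prop} [∀ q x, Decidable (p q x)] (hp : TC0Pred s p)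
    (ha : TC0Nat s a) (hb : TC0Nat s b) :
    TC0Nat s fun q x => if p q x then a q x else b q x := by
  obtain ⟨W, hW, hlt⟩ := ha.exists_lt₂ hb
  refine ⟨⟨W, hW, fun q x => ?_⟩,
    ((hp.comp Prod.fst).ite ha.testBit hb.testBit).congr fun k x => ?_⟩
  · split_ifs
    exacts [(hlt q x).1, (hlt q x).2]
  · split_ifs <;> rfl

theorem two_pow_mul {K : Q → ℕ} (hK : PolyBounded s K) (ha : TC0Nat s a) :
    TC0Nat s fun q x => 2 ^ K q * a q x := by
  obtain ⟨W, hW, hlt⟩ := ha.exists_lt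
  refine ⟨⟨_, hK.add hW, fun q x => ?_⟩, ((TC0Pred.const fun k : Q × ℕ => K k.1 ≤ k.2).and
    (ha.testBit.comp fun k : Q × ℕ => (k.1, k.2 - K k.1))).congr fun k x => ?_⟩
  · rw [pow_add]
    exact Nat.mul_lt_mul_of_pos_left (hlt q x) (Nat.two_pow_pos _)
  · simp [Nat.testBit_two_pow_mul]

protected theorem add (ha : TC0Nat s a) (hb : TC0Nat s b) :
    TC0Nat s fun q x => a q x + b q x := by
  obtain ⟨W, hW, hlt⟩ := ha.exists_lt₂ hb
  have hW' : PolyBounded s fun q => W q + 1 := hW.add (.const s 1)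
  refine of_testBit_lt hW' (fun q x => ?_) ?_
  · rw [pow_succ, mul_two]
    exact add_lt_add (hlt q x).1 (hlt q x).2
  let I : Type := Σ q, Fin (W q + 1)
  have hle : PolyBounded (fun k : I => s k.1) fun k => k.2 :=
    (hW'.comp Sigma.fst).mono fun k => k.2.2.le
  have hcarry : TC0Pred (fun k : I => s k.1) fun k x => ∃ j < (k.2 : ℕ),
      ((a k.1 x).testBit j = true ∧ (b k.1 x).testBit j = true) ∧ ∀ l < (k.2 : ℕ), j < l →
        (a k.1 x).testBit l = true ∨ (b k.1 x).testBit l = true :=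
    .exists_lt hle <| .and
      (.and (ha.testBit.comp fun k : I × ℕ => (k.1.1, k.2))
        (hb.testBit.comp fun k : I × ℕ => (k.1.1, k.2))) <|
      .forall_lt (hle.comp Prod.fst) <|
      .imp (.const fun k : (I × ℕ) × ℕ => k.1.2 < k.2) <|
      .or (ha.testBit.comp fun k : (I × ℕ) × ℕ => (k.1.1.1, k.2))
        (hb.testBit.comp fun k : (I × ℕ) × ℕ => (k.1.1.1, k.2))
  refine (((ha.testBit.comp fun k : I => (k.1, (k.2 : ℕ))).iff
    (hb.testBit.comp fun k : I => (k.1, (k.2 : ℕ)))).iff hcarry).congr fun k x => ?_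
  rw [testBit_add_iff, hasCarry_iff]

theorem two_pow_sub_succ {W : Q → ℕ} (hW : PolyBounded s W) (hlt : ∀ q x, a q x < 2 ^ W q)
    (ha : TC0Nat s a) : TC0Nat s fun q x => 2 ^ W q - (a q x + 1) := by
  refine of_testBit_lt hW (fun q x => Nat.sub_lt (Nat.two_pow_pos _) (Nat.succ_pos _))
    ((ha.testBit.comp fun k : Σ q, Fin (W q) => (k.1, (k.2 : ℕ))).not.congr fun k x => ?_)
  simp [Nat.testBit_two_pow_sub_succ (hlt k.1 x)]

protected theorem lt (ha : TC0Nat s a) (hb : TC0Nat s b) :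
    TC0Pred s fun q x => a q x < b q x := by
  obtain ⟨W, hW, hlt⟩ := ha.exists_lt₂ hb
  -- The sum `2 ^ W - (a + 1) + b` overflows into position `W` if and only if `a < b`.
  refine (((ha.two_pow_sub_succ hW fun q x => (hlt q x).1).add hb).testBit.comp
    fun q => (q, W q)).congr fun q x => ?_
  obtain ⟨h₁, h₂⟩ := hlt q x
  constructor
  · intro hab
    rw [← Nat.sub_add_cancel (show 2 ^ W q ≤ 2 ^ W q - (a q x + 1) + b q x by omega),
      add_comm, Nat.testBit_two_pow_add_eq, Nat.testBit_lt_two_pow (by omega)]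
    rfl
  · intro hbit
    have : 2 ^ W q ≤ 2 ^ W q - (a q x + 1) + b q x := Nat.ge_two_pow_of_testBit hbit
    omega

protected theorem tsub (ha : TC0Nat s a) (hb : TC0Nat s b) :
    TC0Nat s fun q x => a q x - b q x := by
  obtain ⟨W, hW, hlt⟩ := ha.exists_lt₂ hb
  refine of_testBit_lt hW (fun q x => (Nat.sub_le _ _).trans_lt (hlt q x).1)
    ((((ha.lt hb).not.comp Sigma.fst).and
      (((ha.two_pow_sub_succ hW fun q x => (hlt q x).1).add hb).testBit.comp
        fun k : Σ q, Fin (W q) => (k.1, (k.2 : ℕ))).not).congr fun k x => ?_)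
  obtain ⟨q, t⟩ := k
  have := (hlt q x).1
  dsimp only
  obtain hab | hab := lt_or_ge (a q x) (b q x)
  · simp [hab, Nat.sub_eq_zero_of_le hab.le]
  · rw [show a q x - b q x = 2 ^ W q - (2 ^ W q - (a q x + 1) + b q x + 1) by omega,
      Nat.testBit_two_pow_sub_succ (by omega)]
    simp [hab]

section sum

variable {J : Q → Type} [∀ q, Fintype (J q)] {f : ∀ q, J q → (ι q → Bool) → Prop}
  [∀ q j x, Decidable (f q j x)]

theorem sum_two_pow_blocks {K : Q → ℕ} (hK : PolyBounded s fun q => 2 ^ K q)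
    (hJ : ∀ q, Fintype.card (J q) < 2 ^ K q) {u r : ∀ q, J q → ℕ} (hr : ∀ q j, r q j < K q)
    {E : Q → ℕ} (hE : PolyBounded s E) (he : ∀ q j, 2 * K q * u q j + r q j ≤ E q)
    (h : TC0Pred (fun k : Σ q, J q => s k.1) fun k => f k.1 k.2) :
    TC0Nat s fun q x => ∑ j with f q j x, 2 ^ (2 * K q * u q j + r q j) := by
  have hsum : ∀ {q} {e : J q → ℕ} {B} (S : Finset (J q)), (∀ j, e j ≤ B) →
      ∑ j ∈ S, 2 ^ e j < 2 ^ (K q + B) := fun {q e B} S heB => by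
    calc ∑ j ∈ S, 2 ^ e j ≤ #S * 2 ^ B :=
          sum_le_card_nsmul _ _ _ fun j _ => Nat.pow_le_pow_right two_pos (heB j)
      _ < 2 ^ K q * 2 ^ B := by
          gcongr
          exact (card_le_univ S).trans_lt (hJ q)
      _ = 2 ^ (K q + B) := (pow_add _ _ _).symm
  refine ⟨⟨_, (hK.mono fun q => Nat.lt_two_pow_self.le).add hE, fun q x => hsum _ (he q)⟩,
    (TC0Pred.sum (J := fun k : Q × ℕ => J k.1) (a := fun k j => 2 ^ r k.1 j)
      (f := fun k j x => f k.1 j x ∧ u k.1 j = k.2 / (2 * K k.1)) ?_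
      ((h.comp fun k : Σ k : Q × ℕ, J k.1 => ⟨k.1.1, k.2⟩).and
        (.const fun k : Σ k : Q × ℕ, J k.1 => u k.1.1 k.2 = k.1.2 / (2 * K k.1.1)))
      fun k v => v.testBit (k.2 % (2 * K k.1)) = true).congr fun k x => ?_⟩
  · refine ((hK.mul hK).comp Prod.fst).mono fun k => ?_
    rw [← pow_add]
    exact (hsum univ fun j => (hr k.1 j).le).le
  · obtain hJ₀ | ⟨⟨j₀⟩⟩ := isEmpty_or_nonempty (J k.1)
    · simp
    · have hK₀ := (Nat.zero_le _).trans_lt (hr k.1 j₀)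
      rw [testBit_sum_two_pow_blocks _ (by omega) _ _ (fun v => (hsum _ fun j =>
        (hr k.1 j).le).trans_eq (by rw [two_mul])), filter_filter]
      congr!

theorem sum_two_pow {e : ∀ q, J q → ℕ} {E : Q → ℕ}
    (hJ : PolyBounded s fun q => Fintype.card (J q)) (hE : PolyBounded s E)
    (he : ∀ q j, e q j ≤ E q) (h : TC0Pred (fun k : Σ q, J q => s k.1) fun k => f k.1 k.2) :
    TC0Nat s fun q x => ∑ j with f q j x, 2 ^ e q j := by
  let K : Q → ℕ := fun q => Nat.log 2 (Fintype.card (J q)) + 1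
  have hK : PolyBounded s fun q => 2 ^ K q := hJ.two_pow_log_succ
  have hJK (q) : Fintype.card (J q) < 2 ^ K q := Nat.lt_pow_succ_log_self one_lt_two _
  have hdiv (q j) : e q j = K q * (e q j / K q % 2) +
      (2 * K q * (e q j / K q / 2) + e q j % K q) := by
    conv_lhs => rw [← Nat.div_add_mod (e q j) (K q), ← Nat.div_add_mod (e q j / K q) 2]
    ring
  -- Cut positions into blocks of length `K`. If only every other block is occupied, then no carry
  -- leaves its pair of blocks.
  have hpar (c : ℕ) : TC0Nat s fun q x =>
      ∑ j with f q j x ∧ e q j / K q % 2 = c, 2 ^ e q j := by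
    refine ((sum_two_pow_blocks (f := fun q j x => f q j x ∧ e q j / K q % 2 = c)
      (u := fun q j => e q j / K q / 2) (r := fun q j => e q j % K q) hK hJK
      (fun q j => Nat.mod_lt _ (Nat.succ_pos _)) hE
      (fun q j => (Nat.le_add_left _ _).trans ((hdiv q j).ge.trans (he q j)))
      (h.and (.const fun k : Σ q, J q => e k.1 k.2 / K k.1 % 2 = c))).two_pow_mul
        ((hK.mono fun q => Nat.lt_two_pow_self.le).mul (.const s c))).congr fun q x => ?_
    rw [mul_sum]
    refine sum_congr rfl fun j hj => ?_
    rw [← pow_add, ← (mem_filter.1 hj).2.2, ← hdiv]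
  refine ((hpar 0).add (hpar 1)).congr fun q x => ?_
  rw [← sum_filter_add_sum_filter_not _ fun j => e q j / K q % 2 = 0, filter_filter,
    filter_filter]
  simp only [Nat.mod_two_ne_zero]

end sum

protected theorem mul (ha : TC0Nat s a) (hb : TC0Nat s b) :
    TC0Nat s fun q x => a q x * b q x := by
  obtain ⟨W, hW, hlt⟩ := ha.exists_lt₂ hb
  refine (sum_two_pow (J := fun q => Fin (W q) × Fin (W q)) (e := fun q k => (k.1 : ℕ) + k.2)
    (f := fun q k x => (a q x).testBit k.1 = true ∧ (b q x).testBit k.2 = true)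
    ((hW.mul hW).mono fun q => by simp) (hW.add hW) (fun q k => by omega)
    (.and (ha.testBit.comp fun k : Σ q, Fin (W q) × Fin (W q) => (k.1, (k.2.1 : ℕ)))
      (hb.testBit.comp fun k : Σ q, Fin (W q) × Fin (W q) => (k.1, (k.2.2 : ℕ))))).congr
      fun q x => ?_
  conv_lhs => rw [← natVal_testBit (hlt q x).1, ← natVal_testBit (hlt q x).2]
  rw [natVal, natVal, sum_mul_sum, sum_filter, Fintype.sum_prod_type]
  refine sum_congr rfl fun i _ => sum_congr rfl fun j _ => ?_
  simp only [ite_and, pow_add, ite_zero_mul_ite_zero]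

end TC0Nat

/-! ### Integers and fractions -/

/-- A family of integers, depending on bit strings, whose positive and negative parts are computed
by `TC⁰` families of circuits. -/
def TC0Int {Q : Type} (s : Q → ℕ) {ι : Q → Type} (z : ∀ q, (ι q → Bool) → ℤ) : Prop :=
  TC0Nat s (fun q x => (z q x).toNat) ∧ TC0Nat s fun q x => (-z q x).toNat

namespace TC0Int

variable {Q Q₁ : Type} {s : Q → ℕ} {ι : Q → Type} {y z : ∀ q, (ι q → Bool) → ℤ}

theorem comp (hz : TC0Int s z) (e : Q₁ → Q) : TC0Int (fun q => s (e q)) fun q => z (e q) :=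
  ⟨hz.1.comp e, hz.2.comp e⟩

theorem natCast_sub {a b : ∀ q, (ι q → Bool) → ℕ} (ha : TC0Nat s a) (hb : TC0Nat s b) :
    TC0Int s fun q x => (a q x : ℤ) - b q x :=
  ⟨(ha.tsub hb).congr fun q x => by dsimp only; omega,
    (hb.tsub ha).congr fun q x => by dsimp only; omega⟩

theorem const {c : Q → ℤ} (hc : PolyBounded s fun q => (c q).natAbs) :
    TC0Int s fun q (_ : ι q → Bool) => c q :=
  ⟨.const (hc.mono fun q => by omega), .const (hc.mono fun q => by omega)⟩

theorem of_wires {w : Q → ℕ} (hw : PolyBounded s w) (e : ∀ q, IntWire (w q) → ι q) :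
    TC0Int s fun q (x : ι q → Bool) => intVal fun t => x (e q t) := by
  have hsign := TC0Pred.var (s := s) fun q => e q none
  have hval := TC0Nat.of_wires hw fun q t => e q (some t)
  have hzero := TC0Nat.const (ι := ι) (.const s 0)
  convert natCast_sub (hzero.ite hsign hval) (hval.ite hsign hzero) using 3
  rw [intVal]
  split_ifs <;> simp

theorem sumElim {J K : Q → Type} {y : ∀ q, J q → (ι q → Bool) → ℤ}
    {z : ∀ q, K q → (ι q → Bool) → ℤ}
    (hy : TC0Int (fun k : Σ q, J q => s k.1) fun k => y k.1 k.2)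
    (hz : TC0Int (fun k : Σ q, K q => s k.1) fun k => z k.1 k.2) :
    TC0Int (fun k : Σ q, J q ⊕ K q => s k.1) fun k => Sum.elim (y k.1) (z k.1) k.2 := by
  refine ⟨(TC0Nat.sumElim (a := fun q j x => (y q j x).toNat)
    (b := fun q j x => (z q j x).toNat) hy.1 hz.1).congr ?_,
    (TC0Nat.sumElim (a := fun q j x => (-y q j x).toNat)
    (b := fun q j x => (-z q j x).toNat) hy.2 hz.2).congr ?_⟩ <;>
  · rintro ⟨q, j | k⟩ x <;> rfl

theorem ite {p : ∀ q, (ι q → Bool) → Prop} [∀ q x, Decidable (p q x)] (hp : TC0Pred s p)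
    (hy : TC0Int s y) (hz : TC0Int s z) :
    TC0Int s fun q x => if p q x then y q x else z q x :=
  ⟨(hy.1.ite hp hz.1).congr fun q x => by dsimp only; split_ifs <;> rfl,
    (hy.2.ite hp hz.2).congr fun q x => by dsimp only; split_ifs <;> rfl⟩

theorem lt_zero (hz : TC0Int s z) : TC0Pred s fun q x => z q x < 0 :=
  ((TC0Nat.const (.const s 0)).lt hz.2).congr fun q x => by omega

theorem natAbs (hz : TC0Int s z) : TC0Nat s fun q x => (z q x).natAbs :=
  (hz.1.add hz.2).congr fun q x => by omega

end TC0Int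

/-- The value of a bit string as a fraction, where the denominator zero is read as one. -/
def ratVal {w : ℕ} (u : RatWire w → Bool) : ℚ :=
  (intVal fun t => u (.inl t) : ℚ) / (max 1 (natVal fun t => u (.inr t)) : ℕ)

theorem EncodesRat.eq_ratVal {w : ℕ} {u : RatWire w → Bool} {r : ℚ} (h : EncodesRat u r) :
    r = ratVal u := by
  rw [ratVal, max_eq_right (Nat.one_le_iff_ne_zero.2 h.1), ← h.2]

/-- A family of rational numbers, depending on bit strings, that are represented by fractions,
not necessarily reduced, computed by `TC⁰` families of circuits. -/
def TC0Rat {Q : Type} (s : Q → ℕ) {ι : Q → Type} (r : ∀ q, (ι q → Bool) → ℚ) : Prop :=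
  ∃ (z : ∀ q, (ι q → Bool) → ℤ) (d : ∀ q, (ι q → Bool) → ℕ), TC0Int s z ∧ TC0Nat s d ∧
    ∀ q x, d q x ≠ 0 ∧ r q x = z q x / d q x

namespace TC0Rat

variable {Q Q₁ : Type} {s : Q → ℕ} {ι : Q → Type} {r r' : ∀ q, (ι q → Bool) → ℚ}

theorem comp (hr : TC0Rat s r) (e : Q₁ → Q) : TC0Rat (fun q => s (e q)) fun q => r (e q) := by
  obtain ⟨z, d, hz, hd, h⟩ := hr
  exact ⟨_, _, hz.comp e, hd.comp e, fun q => h (e q)⟩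

theorem zero : TC0Rat s fun q (_ : ι q → Bool) => 0 :=
  ⟨_, _, .const (c := fun _ => 0) (.const s 0), .const (.const s 1), fun q x => by simp⟩

theorem of_wires {w : Q → ℕ} (hw : PolyBounded s w) (e : ∀ q, RatWire (w q) → ι q) :
    TC0Rat s fun q (x : ι q → Bool) => ratVal fun t => x (e q t) := by
  have hden := TC0Nat.of_wires hw fun q t => e q (.inr t)
  have hone := TC0Nat.const (ι := ι) (.const s 1)
  refine ⟨_, _, .of_wires hw fun q t => e q (.inl t), hden.ite (hone.lt hden) hone, fun q x => ?_⟩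
  simp only [ratVal, max_def_lt]
  split_ifs
  exacts [⟨by omega, trivial⟩, ⟨one_ne_zero, trivial⟩]

theorem sumElim {J K : Q → Type} {r : ∀ q, J q → (ι q → Bool) → ℚ}
    {r' : ∀ q, K q → (ι q → Bool) → ℚ}
    (hr : TC0Rat (fun k : Σ q, J q => s k.1) fun k => r k.1 k.2)
    (hr' : TC0Rat (fun k : Σ q, K q => s k.1) fun k => r' k.1 k.2) :
    TC0Rat (fun k : Σ q, J q ⊕ K q => s k.1) fun k => Sum.elim (r k.1) (r' k.1) k.2 := by
  obtain ⟨z, d, hz, hd, h⟩ := hr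
  obtain ⟨z', d', hz', hd', h'⟩ := hr'
  refine ⟨_, _, .sumElim (y := fun q j => z ⟨q, j⟩) (z := fun q k => z' ⟨q, k⟩) hz hz',
    .sumElim (a := fun q j => d ⟨q, j⟩) (b := fun q k => d' ⟨q, k⟩) hd hd', ?_⟩
  rintro ⟨q, j | k⟩ x
  exacts [h ⟨q, j⟩ x, h' ⟨q, k⟩ x]

protected theorem sub (hr : TC0Rat s r) (hr' : TC0Rat s r') :
    TC0Rat s fun q x => r q x - r' q x := by
  obtain ⟨z, d, hz, hd, h⟩ := hr
  obtain ⟨z', d', hz', hd', h'⟩ := hr'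
  refine ⟨_, _, .natCast_sub ((hz.1.mul hd').add (hz'.2.mul hd))
    ((hz.2.mul hd').add (hz'.1.mul hd)), hd.mul hd', fun q x => ?_⟩
  obtain ⟨hd₀, hr⟩ := h q x
  obtain ⟨hd₀', hr'⟩ := h' q x
  refine ⟨mul_ne_zero hd₀ hd₀', ?_⟩
  dsimp only
  rw [hr, hr', div_sub_div _ _ (Nat.cast_ne_zero.2 hd₀) (Nat.cast_ne_zero.2 hd₀')]
  conv_lhs => rw [← Int.toNat_sub_toNat_neg (z q x), ← Int.toNat_sub_toNat_neg (z' q x)]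
  push_cast
  ring

end TC0Rat

/-! ### Circuits that output encodings -/

theorem TC0Pred.sumElim_eq_true {Q : Type} {s : Q → ℕ} {ι J K : Q → Type}
    {f : ∀ q, (ι q → Bool) → J q → Bool} {g : ∀ q, (ι q → Bool) → K q → Bool}
    (hf : TC0Pred (fun k : Σ q, J q => s k.1) fun k x => f k.1 x k.2 = true)
    (hg : TC0Pred (fun k : Σ q, K q => s k.1) fun k x => g k.1 x k.2 = true) :
    TC0Pred (fun k : Σ q, J q ⊕ K q => s k.1)
      fun k x => Sum.elim (f k.1 x) (g k.1 x) k.2 = true :=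
  (TC0Pred.sumElim (f := fun q j x => f q x j = true) (g := fun q k x => g q x k = true)
    hf hg).congr (by rintro ⟨q, j | k⟩ x <;> rfl)

/-- The sign-magnitude representation of an integer with at most `w` bits. -/
def encodeInt (w : ℕ) (z : ℤ) : IntWire w → Bool
  | none => decide (z < 0)
  | some t => z.natAbs.testBit t

theorem intVal_encodeInt {w : ℕ} {z : ℤ} (h : z.natAbs < 2 ^ w) : intVal (encodeInt w z) = z := by
  simp only [intVal, encodeInt, natVal_testBit h, decide_eq_true_eq]
  split_ifs <;> omega

theorem TC0Int.pred_encodeInt {Q : Type} {s : Q → ℕ} {ι : Q → Type} {z : ∀ q, (ι q → Bool) → ℤ}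
    (hz : TC0Int s z) (w : Q → ℕ) : TC0Pred (fun k : Σ q, IntWire (w q) => s k.1)
      fun k x => encodeInt (w k.1) (z k.1 x) k.2 = true :=
  .of_cover (fun q => ⟨q, none⟩) (fun k : Σ q, Fin (w q) => ⟨k.1, some k.2⟩)
    (fun | ⟨q, none⟩ => .inl ⟨q, rfl⟩ | ⟨q, some t⟩ => .inr ⟨⟨q, t⟩, rfl⟩)
    (hz.lt_zero.congr fun _ _ => decide_eq_true_iff)
    (hz.natAbs.testBit.comp fun k : Σ q, Fin (w q) => (k.1, (k.2 : ℕ)))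

/-- The representation of the fraction `z / d` with at most `w` bits. -/
def encodeFrac (w : ℕ) (z : ℤ) (d : ℕ) : RatWire w → Bool :=
  Sum.elim (encodeInt w z) fun t => d.testBit t

theorem TC0Int.pred_encodeFrac {Q : Type} {s : Q → ℕ} {ι : Q → Type} {z : ∀ q, (ι q → Bool) → ℤ}
    {d : ∀ q, (ι q → Bool) → ℕ} (hz : TC0Int s z) (hd : TC0Nat s d) (w : Q → ℕ) :
    TC0Pred (fun k : Σ q, RatWire (w q) => s k.1)
      fun k x => encodeFrac (w k.1) (z k.1 x) (d k.1 x) k.2 = true :=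
  .sumElim_eq_true (f := fun q x => encodeInt (w q) (z q x))
    (g := fun q x (t : Fin (w q)) => (d q x).testBit t) (hz.pred_encodeInt w)
    (hd.testBit.comp fun k : Σ q, Fin (w q) => (k.1, (k.2 : ℕ)))

theorem encodesRat_encodeFrac {w d : ℕ} {z : ℤ} (hd₀ : d ≠ 0) (hz : z.natAbs < 2 ^ w)
    (hd : d < 2 ^ w) : EncodesRat (encodeFrac w z d) (z / d) := by
  constructor
  · simpa only [encodeFrac, Sum.elim_inr, natVal_testBit hd]
  · simp only [encodeFrac, Sum.elim_inr, Sum.elim_inl, natVal_testBit hd, intVal_encodeInt hz]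

theorem TC0Rat.exists_encoding {Q Q₁ : Type} {s : Q → ℕ} {e : Q₁ → Q} {ι : Q₁ → Type}
    {r : ∀ q, (ι q → Bool) → ℚ} (hr : TC0Rat (fun q => s (e q)) r) :
    ∃ L, PolyBounded s L ∧ ∀ w : Q → ℕ, (∀ q, L q ≤ w q) →
      ∃ g : ∀ q, (ι q → Bool) → RatWire (w (e q)) → Bool,
        TC0Pred (fun k : Σ q, RatWire (w (e q)) => s (e k.1)) (fun k x => g k.1 x k.2 = true) ∧
        ∀ q x, EncodesRat (g q x) (r q x) := by
  obtain ⟨z, d, hz, hd, h⟩ := hr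
  obtain ⟨V, hV, hzV⟩ := hz.natAbs.exists_lt_comp
  obtain ⟨W, hW, hdW⟩ := hd.exists_lt_comp
  refine ⟨_, hV.add hW, fun w hw => ⟨fun q x => encodeFrac (w (e q)) (z q x) (d q x),
    (hz.pred_encodeFrac hd fun q => w (e q)), fun q x => ?_⟩⟩
  have := hw (e q)
  rw [(h q x).2]
  exact encodesRat_encodeFrac (h q x).1
    ((hzV q x).trans_le (Nat.pow_le_pow_right two_pos (by omega)))
    ((hdW q x).trans_le (Nat.pow_le_pow_right two_pos (by omega)))

section output

variable {Q : Type} {s : Q → ℕ} {M N : Q → ℕ}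

theorem exists_circuit_encodesVec_sub {l n : Q → ℕ} (hl : PolyBounded s l) (hn : PolyBounded s n)
    (pos neg : ∀ q, Fin (n q) → Fin (N q)) :
    ∃ (L : Q → ℕ) (R : ∀ q, Circuit (Fin (N q) × RatWire (l q)) (Fin (n q) × RatWire (L q))),
      PolyBounded s L ∧ IsTC0 s R ∧ ∀ q v (x : Fin (N q) → ℚ), EncodesVec v x →
        EncodesVec ((R q).eval v) fun j => x (pos q j) - x (neg q j) := by
  let coord : ∀ q, Fin (N q) → (Fin (N q) × RatWire (l q) → Bool) → ℚ :=
    fun _ i v => ratVal fun t => v (i, t)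
  have hcoord (i : ∀ q, Fin (n q) → Fin (N q)) :
      TC0Rat (fun k : Σ q, Fin (n q) => s k.1) fun k => coord k.1 (i k.1 k.2) :=
    .of_wires (hl.comp Sigma.fst) fun (k : Σ q, Fin (n q)) t => (i k.1 k.2, t)
  obtain ⟨L, hL, hg⟩ := ((hcoord pos).sub (hcoord neg)).exists_encoding
  obtain ⟨g, hg, hr⟩ := hg L fun _ => le_rfl
  obtain ⟨R, hR, heval⟩ := TC0Pred.exists_circuit (s := s)
    (ι := fun q => Fin (N q) × RatWire (l q)) (κ := fun q => Fin (n q) × RatWire (L q))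
    (g := fun q v k => g ⟨q, k.1⟩ v k.2)
    ((hn.mul ((hL.add (.const s 1)).add hL)).mono fun q => by simp)
    (hg.comp fun k : Σ q, Fin (n q) × RatWire (L q) => ⟨⟨k.1, k.2.1⟩, k.2.2⟩)
  refine ⟨L, R, hL, hR, fun q v x ⟨_, hx⟩ => ⟨le_rfl, fun j => ?_⟩⟩
  dsimp only
  rw [(hx (pos q j)).eq_ratVal, (hx (neg q j)).eq_ratVal]
  simp only [heval]
  exact hr ⟨q, j⟩ v

theorem exists_circuit_encodesPadded {ι : Q → Type} (hM : PolyBounded s M) (hN : PolyBounded s N)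
    {A : ∀ q, (ι q → Bool) → Matrix (Fin (M q)) (Fin (N q)) ℤ}
    {b : ∀ q, (ι q → Bool) → Fin (M q) → ℚ}
    (hA : TC0Int (fun k : Σ q, Fin (M q) × Fin (N q) => s k.1) fun k x => A k.1 x k.2.1 k.2.2)
    (hb : TC0Rat (fun k : Σ q, Fin (M q) => s k.1) fun k x => b k.1 x k.2) :
    ∃ (W : Q → ℕ) (C : ∀ q, Circuit (ι q) (PadWire (M q) (N q) (W q))),
      PolyBounded s W ∧ IsTC0 s C ∧ ∀ q x, EncodesPadded ((C q).eval x) (A q x) (b q x) := by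
  obtain ⟨V, hV, hAV⟩ := hA.natAbs.exists_lt_comp
  obtain ⟨L, hL, hg⟩ := hb.exists_encoding
  let W := fun q => V q + L q + M q + N q
  have hW : PolyBounded s W := ((hV.add hL).add hM).add hN
  have hlt {q a B} (ha : a < 2 ^ B) (hB : B ≤ W q) : a < 2 ^ W q :=
    ha.trans_le (Nat.pow_le_pow_right two_pos hB)
  obtain ⟨g, hg, hr⟩ := hg W fun q => by dsimp only [W]; omega
  let entries := fun q (x : ι q → Bool) (k : Fin (M q) × Fin (N q) × IntWire (W q)) =>
    encodeInt (W q) (A q x k.1 k.2.1) k.2.2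
  let rhs := fun q (x : ι q → Bool) (k : Fin (M q) × RatWire (W q)) => g ⟨q, k.1⟩ x k.2
  let dims := fun q => Sum.elim (fun t : Fin (W q) => (M q).testBit t)
    fun t : Fin (W q) => (N q).testBit t
  have hsys := TC0Pred.sumElim_eq_true (s := s) (f := entries) (g := rhs)
    ((hA.pred_encodeInt fun k => W k.1).comp
      fun k : Σ q, Fin (M q) × Fin (N q) × IntWire (W q) => ⟨⟨k.1, k.2.1, k.2.2.1⟩, k.2.2.2⟩)
    (hg.comp fun k : Σ q, Fin (M q) × RatWire (W q) => ⟨⟨k.1, k.2.1⟩, k.2.2⟩)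
  obtain ⟨C, hC, heval⟩ := TC0Pred.exists_circuit (s := s)
    (κ := fun q => PadWire (M q) (N q) (W q))
    (g := fun q x => Sum.elim (Sum.elim (entries q x) (rhs q x)) (dims q))
    ((((hM.mul (hN.mul (hW.add (.const s 1)))).add
      (hM.mul ((hW.add (.const s 1)).add hW))).add (hW.add hW)).mono fun q => by simp)
    (.sumElim_eq_true (f := fun q x => Sum.elim (entries q x) (rhs q x)) (g := fun q _ => dims q)
      hsys (.const fun k : Σ q, Fin (W q) ⊕ Fin (W q) => dims k.1 k.2 = true))
  refine ⟨W, C, hW, hC, fun q x => ?_⟩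
  rw [heval]
  refine ⟨natVal_testBit (hlt Nat.lt_two_pow_self (by dsimp only [W]; omega)),
    natVal_testBit (hlt Nat.lt_two_pow_self (by dsimp only [W]; omega)), le_rfl, le_rfl,
    fun i j => intVal_encodeInt (hlt (hAV ⟨q, i, j⟩ x) (by dsimp only [W]; omega)),
    fun i => hr ⟨q, i⟩ x⟩

end output

/-! ### Reductions given by families of systems -/

/-- `x` solves the system `A x = b` whose rows and columns are indexed by arbitrary types. -/
def Solves {ρ γ : Type} [Fintype γ] (K : Type) [Field K] (A : Matrix ρ γ ℤ) (b : ρ → ℚ)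
    (x : γ → K) : Prop :=
  ∀ i, ∑ j, (A i j : K) * x j = b i

theorem isSol_submatrix_symm {ρ γ K : Type} [Fintype γ] [Field K] {M N : ℕ} (er : ρ ≃ Fin M)
    (ec : γ ≃ Fin N) {A : Matrix ρ γ ℤ} {b : ρ → ℚ} {x : Fin N → K} :
    IsSol K (A.submatrix er.symm ec.symm) (b ∘ er.symm) x ↔ Solves K A b (x ∘ ec) := by
  simp only [IsSol, Solves, er.forall_congr_left, ← ec.sum_comp, Matrix.submatrix_apply,
    Equiv.symm_apply_apply, Function.comp_apply]

/-- The size parameter of a linear system. -/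
abbrev sysSize (p : ℕ × ℕ × ℕ) : ℕ := p.1 + p.2.1 + p.2.2

/-- The matrix that a bit string represents. -/
def decodeMatrix {m n w : ℕ} (u : SysWire m n w → Bool) : Matrix (Fin m) (Fin n) ℤ :=
  fun i j => intVal fun t => u (.inl (i, j, t))

/-- The right-hand side that a bit string represents. -/
def decodeRhs {m n w : ℕ} (u : SysWire m n w → Bool) (i : Fin m) : ℚ :=
  ratVal fun t => u (.inr (i, t))

theorem tc0Rat_decodeRhs :
    TC0Rat (fun k : Σ p : ℕ × ℕ × ℕ, Fin p.1 => sysSize k.1)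
      fun k (u : SysWire k.1.1 k.1.2.1 k.1.2.2 → Bool) => decodeRhs u k.2 :=
  .of_wires (w := fun k : Σ p : ℕ × ℕ × ℕ, Fin p.1 => k.1.2.2)
    (.of_le fun _ => Nat.le_add_left _ _) fun k t => Sum.inr (k.2, t)

theorem EncodesSystem.eq_decode {m n w : ℕ} {u : SysWire m n w → Bool}
    {A : Matrix (Fin m) (Fin n) ℤ} {b : Fin m → ℚ} (h : EncodesSystem u A b) :
    A = decodeMatrix u ∧ b = decodeRhs u :=
  ⟨Matrix.ext fun i j => (h.1 i j).symm, funext fun i => (h.2 i).eq_ratVal⟩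

theorem TC0Reducible.mono_right {𝒞 𝒟 𝒟' : MatrixClass} (h : TC0Reducible 𝒞 𝒟)
    (h𝒟 : ∀ m n, 𝒟 m n ⊆ 𝒟' m n) : TC0Reducible 𝒞 𝒟' := by
  obtain ⟨M, N, W, L, F, R, hM, hN, hW, hL, hF, hR, h⟩ := h
  refine ⟨M, N, W, L, F, R, hM, hN, hW, hL, hF, hR, fun m n w A b u hA hu => ?_⟩
  obtain ⟨m', n', A', b', hA', h⟩ := h m n w A b u hA hu
  exact ⟨m', n', A', b', h𝒟 _ _ hA', h⟩

theorem TC0Reducible.of_systems {𝒞 𝒟 : MatrixClass} {ρ γ : ℕ × ℕ × ℕ → Type}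
    [∀ p, Fintype (γ p)] {M N : ℕ × ℕ × ℕ → ℕ} (hM : PolyBounded sysSize M)
    (hN : PolyBounded sysSize N) (er : ∀ p, ρ p ≃ Fin (M p)) (ec : ∀ p, γ p ≃ Fin (N p))
    {A' : ∀ p : ℕ × ℕ × ℕ, (SysWire p.1 p.2.1 p.2.2 → Bool) → Matrix (ρ p) (γ p) ℤ}
    {b' : ∀ p : ℕ × ℕ × ℕ, (SysWire p.1 p.2.1 p.2.2 → Bool) → ρ p → ℚ}
    (hA' : TC0Int (fun k : Σ p, ρ p × γ p => sysSize k.1) fun k u => A' k.1 u k.2.1 k.2.2)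
    (hb' : TC0Rat (fun k : Σ p, ρ p => sysSize k.1) fun k u => b' k.1 u k.2)
    (h𝒟 : ∀ p u, (A' p u).submatrix (er p).symm (ec p).symm ∈ 𝒟 (M p) (N p))
    (pos neg : ∀ p : ℕ × ℕ × ℕ, Fin p.2.1 → γ p)
    (hsolvable : ∀ p u (x : Fin p.2.1 → ℝ), IsSol ℝ (decodeMatrix u) (decodeRhs u) x →
      ∃ x', Solves ℝ (A' p u) (b' p u) x')
    (hrecover : ∀ (K : Type) [Field K] p u (x' : γ p → K), Solves K (A' p u) (b' p u) x' →
      IsSol K (decodeMatrix u) (decodeRhs u) fun j => x' (pos p j) - x' (neg p j)) :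
    TC0Reducible 𝒞 𝒟 := by
  obtain ⟨W, F, hW, hF, hFeval⟩ := exists_circuit_encodesPadded hM hN
    (A := fun p u => (A' p u).submatrix (er p).symm (ec p).symm)
    (b := fun p u => b' p u ∘ (er p).symm)
    (hA'.comp fun k : Σ p, Fin (M p) × Fin (N p) => ⟨k.1, (er k.1).symm k.2.1, (ec k.1).symm k.2.2⟩)
    (hb'.comp fun k : Σ p, Fin (M p) => ⟨k.1, (er k.1).symm k.2⟩)
  obtain ⟨L, R, hL, hR, hReval⟩ := exists_circuit_encodesVec_sub
    (s := fun q : (ℕ × ℕ × ℕ) × ℕ => sysSize q.1 + q.2) (N := fun q => N q.1) (l := fun q => q.2)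
    (n := fun q => q.1.2.1) (.of_le fun q => by omega)
    (.of_le fun q => by dsimp only [sysSize]; omega)
    (fun q j => ec q.1 (pos q.1 j)) fun q j => ec q.1 (neg q.1 j)
  refine ⟨M, N, W, L, F, R, hM, hN, hW, hL, hF, hR, fun m n w A b u _ hu => ?_⟩
  obtain ⟨rfl, rfl⟩ := hu.eq_decode
  refine ⟨_, _, _, _, h𝒟 (m, n, w) u, hFeval (m, n, w) u, ⟨?_, ?_⟩, fun l x' v hx' hv => ?_⟩
  · rintro ⟨x, hx⟩
    obtain ⟨x', hx'⟩ := hsolvable (m, n, w) u x hx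
    exact ⟨x' ∘ (ec _).symm, (isSol_submatrix_symm _ _).2 (by simpa [Function.comp_assoc])⟩
  · rintro ⟨x', hx'⟩
    exact ⟨_, hrecover ℝ (m, n, w) u _ ((isSol_submatrix_symm _ _).1 hx')⟩
  · exact ⟨_, hReval ((m, n, w), l) v x' hv,
      hrecover ℚ (m, n, w) u _ ((isSol_submatrix_symm _ _).1 hx')⟩

/-! ### Two-commodity systems -/

/-- The kinds of 2-commodity equations between two vertices: they compare the values of `x`, of
`y`, or of `x - y`. -/
inductive Commodity
  | x
  | y
  | diff

namespace Commodity

/-- The coefficient of `x` in the compared quantity. -/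
@[simp]
def xCoeff : Commodity → ℤ
  | x => 1
  | y => 0
  | diff => 1

/-- The coefficient of `y` in the compared quantity. -/
@[simp]
def yCoeff : Commodity → ℤ
  | x => 0
  | y => 1
  | diff => -1

end Commodity

/-- The left-hand side of a 2-commodity equation between the vertices `head` and `tail`. -/
structure Edge (V : Type) where
  /-- The compared quantity. -/
  kind : Commodity
  /-- The vertex whose quantity counts positively. -/
  head : V
  /-- The vertex whose quantity counts negatively. -/
  tail : V

section Edge

variable {V ρ : Type}

namespace Edge

open Classical in
/-- The incidence vector of an edge: `1` at the head and `-1` at the tail. -/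
noncomputable def incidence (e : Edge V) : V → ℤ :=
  Pi.single e.head 1 - Pi.single e.tail 1

/-- The coefficient vector of an edge; the variables `x_v` come before the variables `y_v`. -/
noncomputable def coeff (e : Edge V) : V ⊕ V → ℤ :=
  Sum.elim (e.kind.xCoeff • e.incidence) (e.kind.yCoeff • e.incidence)

theorem sum_incidence_mul [Fintype V] {R : Type} [CommRing R] (e : Edge V) (p : V → R) :
    ∑ v, (e.incidence v : R) * p v = p e.head - p e.tail := by
  classical
  simp [incidence, Pi.single_apply, sub_mul]

theorem sum_coeff_mul [Fintype V] {R : Type} [CommRing R] (e : Edge V) (p : V ⊕ V → R) :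
    ∑ a, (e.coeff a : R) * p a =
      e.kind.xCoeff * (p (.inl e.head) - p (.inl e.tail)) +
        e.kind.yCoeff * (p (.inr e.head) - p (.inr e.tail)) := by
  simp [coeff, mul_assoc, ← mul_sum, sum_incidence_mul e fun v => p (.inl v),
    sum_incidence_mul e fun v => p (.inr v)]

theorem sum_coeff [Fintype V] (e : Edge V) : ∑ a, e.coeff a = 0 := by
  simpa using e.sum_coeff_mul (R := ℤ) 1

theorem natAbs_coeff_le (e : Edge V) (a : V ⊕ V) : (e.coeff a).natAbs ≤ 1 := by
  obtain ⟨kind, u, v⟩ := e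
  rcases a with a | a <;> cases kind <;> by_cases hu : a = u <;> by_cases hv : a = v <;>
    simp_all [coeff, incidence]

theorem incidence_ne_zero {e : Edge V} (he : e.head ≠ e.tail) {v : V}
    (hv : e.head = v ∨ e.tail = v) : e.incidence v ≠ 0 := by
  obtain rfl | rfl := hv <;> simp [incidence, he, he.symm]

theorem sum_filter_pos_incidence [Fintype V] {e : Edge V} (he : e.head ≠ e.tail) (c : ℤ) :
    ∑ v, (if 0 < c * e.incidence v then c * e.incidence v else 0) = |c| := by
  classical
  have split (v : V) : (if 0 < c * e.incidence v then c * e.incidence v else 0) =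
      (if v = e.head then max c 0 else 0) + if v = e.tail then max (-c) 0 else 0 := by
    simp only [incidence, Pi.sub_apply, Pi.single_apply]
    grind
  simp only [split, sum_add_distrib, sum_ite_eq', mem_univ, if_true]
  grind

theorem sum_filter_pos_coeff [Fintype V] {e : Edge V} (he : e.head ≠ e.tail) :
    ∑ a with 0 < e.coeff a, e.coeff a = |e.kind.xCoeff| + |e.kind.yCoeff| := by
  rw [sum_filter, Fintype.sum_sum_type]
  exact congrArg₂ _ (sum_filter_pos_incidence he _) (sum_filter_pos_incidence he _)

theorem isTwoCommodityRow_coeff {k : ℕ} (ev : V ≃ Fin k) {e : Edge V} (he : e.head ≠ e.tail) :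
    IsTwoCommodityRow (e.coeff ∘ ((Equiv.sumCongr ev ev).trans finSumFinEquiv).symm) := by
  classical
  refine ⟨1, ev e.head, ev e.tail, one_ne_zero, ev.injective.ne he, ?_⟩
  have xVar_comp (u : V) : xVar (ev u) ∘ (Equiv.sumCongr ev ev).trans finSumFinEquiv =
      Sum.elim (Pi.single u 1) 0 := by
    ext (v | v)
    · simp [xVar, Pi.single_apply]
    · simpa [xVar, Pi.single_apply, Fin.ext_iff] using by omega
  have yVar_comp (u : V) : yVar (ev u) ∘ (Equiv.sumCongr ev ev).trans finSumFinEquiv =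
      Sum.elim (0 : V → ℤ) (Pi.single u 1) := by
    ext (v | v)
    · simpa [yVar, Pi.single_apply, Fin.ext_iff] using by omega
    · simp [yVar, Pi.single_apply]
  simp only [one_smul, Equiv.comp_symm_eq, Pi.sub_comp, xVar_comp, yVar_comp]
  rcases h : e.kind <;> [left; (right; left); (right; right)] <;> ext (v | v) <;>
    simp [-Sum.elim_single_zero, -Sum.elim_zero_single, coeff, incidence, h,
      neg_add_eq_sub]

end Edge

/-- The matrix of the 2-commodity system with the given edges. -/
noncomputable def edgeMatrix (edges : ρ → Edge V) : Matrix ρ (V ⊕ V) ℤ :=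
  .of fun r => (edges r).coeff

theorem solves_edgeMatrix [Fintype V] {K : Type} [Field K] {edges : ρ → Edge V} {b : ρ → ℚ}
    {p : V ⊕ V → K} : Solves K (edgeMatrix edges) b p ↔ ∀ r,
      (edges r).kind.xCoeff * (p (.inl (edges r).head) - p (.inl (edges r).tail)) +
        (edges r).kind.yCoeff * (p (.inr (edges r).head) - p (.inr (edges r).tail)) = b r := by
  simp only [Solves, edgeMatrix, Matrix.of_apply, Edge.sum_coeff_mul]

theorem edgeMatrix_submatrix_mem [Finite V] {M k : ℕ} (er : ρ ≃ Fin M) (ev : V ≃ Fin k)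
    {edges : ρ → Edge V} (hne : ∀ r, (edges r).head ≠ (edges r).tail)
    (hcover : ∀ v, ∃ r, (edges r).kind = .diff ∧ ((edges r).head = v ∨ (edges r).tail = v)) :
    (edgeMatrix edges).submatrix er.symm
      ((Equiv.sumCongr ev ev).trans finSumFinEquiv).symm ∈
        classGz2 M (k + k) ∩ classMC2 M (k + k) := by
  have := Fintype.ofEquiv _ ev.symm
  set ec := (Equiv.sumCongr ev ev).trans finSumFinEquiv
  have sum_pos (i : Fin M) : ∃ n : ℕ, ∑ j with 0 < (edges (er.symm i)).coeff (ec.symm j),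
      (edges (er.symm i)).coeff (ec.symm j) = 2 ^ n := by
    rw [sum_filter, ec.symm.sum_comp fun a =>
      if 0 < (edges (er.symm i)).coeff a then (edges (er.symm i)).coeff a else 0, ← sum_filter,
      Edge.sum_filter_pos_coeff (hne _)]
    cases (edges (er.symm i)).kind
    exacts [⟨0, rfl⟩, ⟨0, rfl⟩, ⟨1, rfl⟩]
  refine ⟨⟨⟨⟨fun i => ?_, fun j => ?_⟩, fun i => ?_⟩, sum_pos⟩, k, rfl, fun i =>
    Edge.isTwoCommodityRow_coeff ev (hne _)⟩
  · by_contra! hzero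
    obtain ⟨n, hn⟩ := sum_pos i
    exact (pow_ne_zero n two_ne_zero) (hn.symm.trans (sum_eq_zero fun j _ => hzero j))
  · obtain ⟨a, rfl⟩ := ec.surjective j
    obtain ⟨r, hkind, hv⟩ := hcover (Sum.elim id id a)
    refine ⟨er r, ?_⟩
    have hinc := Edge.incidence_ne_zero (hne r) hv
    rcases a with v | v <;>
      simpa [edgeMatrix, Edge.coeff, hkind] using hinc
  · exact (ec.symm.sum_comp (edges (er.symm i)).coeff).trans (Edge.sum_coeff _)

end Edge

/-! ### Straight-line programs with additions -/

/-- The nodes of a straight-line program: the constant zero, the inputs, and the gates. -/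
inductive Node (I G : Type)
  | zero
  | input (i : I)
  | gate (g : G)

/-- The vertices of the 2-commodity system of a straight-line program: the constant zero, encoded
as `Sum.inl none`, the inputs, and three vertices for every gate, the first of which carries its
value. -/
abbrev Vertex (I G : Type) : Type := Option I ⊕ (G × Fin 3)

/-- The equations of the 2-commodity system of a straight-line program: one for every input, six
for every gate, and one for every constraint. -/
abbrev Equation (I G F : Type) : Type := I ⊕ ((G × Fin 6) ⊕ F)

/-- The vertex that carries the value of a node. -/
def Node.vertex {I G : Type} : Node I G → Vertex I G
  | zero => .inl none
  | input i => .inl (some i)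
  | gate g => .inr (g, 0)

theorem Node.vertex_injective {I G : Type} : (Node.vertex : Node I G → Vertex I G).Injective := by
  rintro (_ | i | g) (_ | j | h) <;> simp [Node.vertex]

/-- A straight-line program in which every gate adds the values of two nodes, together with
constraints that prescribe the differences of the values of two nodes. -/
structure AddProgram (I G F : Type) where
  /-- The first summand of a gate. -/
  left : G → Node I G
  /-- The second summand of a gate. -/
  right : G → Node I G
  /-- The node whose value counts positively in a constraint. -/
  pos : F → Node I G
  /-- The node whose value counts negatively in a constraint. -/
  neg : F → Node I G

namespace AddProgram

variable {I G F : Type}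

/-- The program in which the second summand of the gates outside `c` is zero. -/
def mask (P : AddProgram I G F) (c : G → Bool) : AddProgram I G F :=
  { P with right := fun g => if c g then P.right g else .zero }

/-- `z` assigns to every node the value that it has in a run of the program. -/
structure IsTrace {K : Type} [Field K] (P : AddProgram I G F) (z : Node I G → K) : Prop where
  zero : z .zero = 0
  gate (g : G) : z (.gate g) = z (P.left g) + z (P.right g)

/-- The edges of the 2-commodity system of a program. -/
def edge (P : AddProgram I G F) : Equation I G F → Edge (Vertex I G)
  | .inl i => ⟨.diff, .inl (some i), .inl none⟩
  | .inr (.inl (g, r)) =>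
    ![⟨.diff, .inr (g, 0), .inl none⟩, ⟨.x, .inr (g, 1), (P.left g).vertex⟩,
      ⟨.y, .inr (g, 1), .inl none⟩, ⟨.diff, .inr (g, 2), .inr (g, 1)⟩,
      ⟨.y, .inr (g, 2), (P.right g).vertex⟩, ⟨.x, .inr (g, 0), .inr (g, 2)⟩] r
  | .inr (.inr k) => ⟨.x, (P.pos k).vertex, (P.neg k).vertex⟩

/-- The right-hand side of the 2-commodity system of a program. -/
def edgeRhs (I G : Type) {F : Type} (b : F → ℚ) : Equation I G F → ℚ :=
  Sum.elim 0 (Sum.elim 0 b)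

theorem head_edge_ne_tail {P : AddProgram I G F} (hP : ∀ k, P.pos k ≠ P.neg k)
    (r : Equation I G F) : (P.edge r).head ≠ (P.edge r).tail := by
  have inr_ne_vertex (g : G) (t : Fin 3) (ht : t ≠ 0) (v : Node I G) : .inr (g, t) ≠ v.vertex := by
    cases v <;> simp [Node.vertex, ht]
  rcases r with i | ⟨g, r⟩ | k
  · simp [edge]
  · fin_cases r <;> simp [edge, inr_ne_vertex]
  · exact Node.vertex_injective.ne (hP k)

theorem exists_edge_diff [Nonempty I] (P : AddProgram I G F) (v : Vertex I G) :
    ∃ r, (P.edge r).kind = .diff ∧ ((P.edge r).head = v ∨ (P.edge r).tail = v) := by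
  obtain (_ | i) | ⟨g, t⟩ := v
  · exact ⟨.inl (Classical.arbitrary I), rfl, .inr rfl⟩
  · exact ⟨.inl i, rfl, .inl rfl⟩
  · fin_cases t
    exacts [⟨.inr (.inl (g, 0)), rfl, .inl rfl⟩, ⟨.inr (.inl (g, 3)), rfl, .inr rfl⟩,
      ⟨.inr (.inl (g, 3)), rfl, .inl rfl⟩]

theorem edge_mask (P : AddProgram I G F) (c : G → Bool) (r : Equation I G F) :
    (P.mask c).edge r =
      if Sum.elim (fun _ => false) (Sum.elim (fun k => c k.1) fun _ => false) r then P.edge r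
      else (P.mask fun _ => false).edge r := by
  rcases r with i | ⟨g, r⟩ | k
  · rfl
  · by_cases hc : c g <;> fin_cases r <;> simp [edge, mask, hc]
  · rfl

section Solutions

variable [Fintype I] [Fintype G] {K : Type} [Field K] {P : AddProgram I G F} {b : F → ℚ}

theorem sub_eq_sub_of_solves {p : Vertex I G ⊕ Vertex I G → K}
    (h : Solves K (edgeMatrix P.edge) (edgeRhs I G b) p) (v : Node I G) :
    p (.inl v.vertex) - p (.inl (.inl none)) = p (.inr v.vertex) - p (.inr (.inl none)) := by
  rw [solves_edgeMatrix] at h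
  cases v with
  | zero => simp [Node.vertex]
  | input i =>
    have : p (.inl (.inl (some i))) - p (.inl (.inl none)) +
        (p (.inr (.inl none)) - p (.inr (.inl (some i)))) = 0 := by
      simpa [edge, edgeRhs] using h (.inl i)
    simp only [Node.vertex]
    linear_combination this
  | gate g =>
    have : p (.inl (.inr (g, 0))) - p (.inl (.inl none)) +
        (p (.inr (.inl none)) - p (.inr (.inr (g, 0)))) = 0 := by
      simpa [edge, edgeRhs] using h (.inr (.inl (g, 0)))
    simp only [Node.vertex]
    linear_combination this

theorem isTrace_of_solves {p : Vertex I G ⊕ Vertex I G → K}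
    (h : Solves K (edgeMatrix P.edge) (edgeRhs I G b) p) :
    P.IsTrace fun v => p (.inl v.vertex) - p (.inl (.inl none)) := by
  refine ⟨sub_self _, fun g => ?_⟩
  have y_right := sub_eq_sub_of_solves h (P.right g)
  rw [solves_edgeMatrix] at h
  have x₁ : p (.inl (.inr (g, 1))) = p (.inl (P.left g).vertex) := by
    simpa [edge, edgeRhs, sub_eq_zero] using h (.inr (.inl (g, 1)))
  have y₁ : p (.inr (.inr (g, 1))) = p (.inr (.inl none)) := by
    simpa [edge, edgeRhs, sub_eq_zero] using h (.inr (.inl (g, 2)))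
  have diff₂ : p (.inl (.inr (g, 2))) - p (.inl (.inr (g, 1))) +
      (p (.inr (.inr (g, 1))) - p (.inr (.inr (g, 2)))) = 0 := by
    simpa [edge, edgeRhs] using h (.inr (.inl (g, 3)))
  have y₂ : p (.inr (.inr (g, 2))) = p (.inr (P.right g).vertex) := by
    simpa [edge, edgeRhs, sub_eq_zero] using h (.inr (.inl (g, 4)))
  have x₀ : p (.inl (.inr (g, 0))) = p (.inl (.inr (g, 2))) := by
    simpa [edge, edgeRhs, sub_eq_zero] using h (.inr (.inl (g, 5)))
  change p (.inl (.inr (g, 0))) - _ = _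
  linear_combination x₀ + diff₂ + y₂ - y_right + x₁ - y₁

theorem sub_eq_of_solves {p : Vertex I G ⊕ Vertex I G → K}
    (h : Solves K (edgeMatrix P.edge) (edgeRhs I G b) p) (k : F) :
    p (.inl (P.pos k).vertex) - p (.inl (P.neg k).vertex) = b k := by
  simpa [edge, edgeRhs] using solves_edgeMatrix.1 h (.inr (.inr k))

theorem exists_solves_of_isTrace {z : Node I G → K} (hz : P.IsTrace z)
    (hb : ∀ k, z (P.pos k) - z (P.neg k) = b k) :
    ∃ p, Solves K (edgeMatrix P.edge) (edgeRhs I G b) p := by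
  let val : Option I → K := fun o => o.elim 0 fun i => z (.input i)
  let p : Vertex I G ⊕ Vertex I G → K := Sum.elim
    (Sum.elim val fun a => ![z (.gate a.1), z (P.left a.1), z (.gate a.1)] a.2)
    (Sum.elim val fun a => ![z (.gate a.1), 0, z (P.right a.1)] a.2)
  have hx (v : Node I G) : p (.inl v.vertex) = z v := by
    cases v <;> simp [p, val, Node.vertex, hz.zero]
  have hy (v : Node I G) : p (.inr v.vertex) = z v := by
    cases v <;> simp [p, val, Node.vertex, hz.zero]
  have hgate (g : G) : p (.inl (.inr (g, 0))) = z (P.left g) + z (P.right g) ∧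
      p (.inr (.inr (g, 0))) = z (P.left g) + z (P.right g) ∧
      p (.inl (.inr (g, 1))) = z (P.left g) ∧ p (.inr (.inr (g, 1))) = 0 ∧
      p (.inl (.inr (g, 2))) = z (P.left g) + z (P.right g) ∧
      p (.inr (.inr (g, 2))) = z (P.right g) := by
    simp [p, hz.gate]
  have hnone : p (.inl (.inl none)) = 0 ∧ p (.inr (.inl none)) = 0 := ⟨rfl, rfl⟩
  refine ⟨p, solves_edgeMatrix.2 ?_⟩
  rintro (i | ⟨g, r⟩ | k)
  · simp [edge, edgeRhs, p]
  · fin_cases r <;> simp [edge, edgeRhs, hx, hy, hgate, hnone]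
  · simp [edge, edgeRhs, hx, hb]

end Solutions

theorem tc0Int_edgeMatrix_mask {Q : Type} {s : Q → ℕ} {ι I G F : Q → Type}
    (P : ∀ q, AddProgram (I q) (G q) (F q)) {c : ∀ q, (ι q → Bool) → G q → Bool}
    (hc : TC0Pred (fun k : Σ q, G q => s k.1) fun k u => c k.1 u k.2 = true) :
    TC0Int (fun k : Σ q, Equation (I q) (G q) (F q) × (Vertex (I q) (G q) ⊕ Vertex (I q) (G q)) =>
      s k.1) fun k u => edgeMatrix ((P k.1).mask (c k.1 u)).edge k.2.1 k.2.2 := by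
  have const_coeff (e : ∀ q, Equation (I q) (G q) (F q) → Edge (Vertex (I q) (G q))) :
      TC0Int (ι := fun k : Σ q, Equation (I q) (G q) (F q) ×
        (Vertex (I q) (G q) ⊕ Vertex (I q) (G q)) => ι k.1) (fun k => s k.1)
        fun k _ => (e k.1 k.2.1).coeff k.2.2 :=
    .const ((PolyBounded.const _ 1).mono fun k => (e k.1 k.2.1).natAbs_coeff_le k.2.2)
  have hcond : TC0Pred (fun k : Σ q, Equation (I q) (G q) (F q) => s k.1) fun k u =>
      Sum.elim (fun _ => false) (Sum.elim (fun a => c k.1 u a.1) fun _ => false) k.2 = true := by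
    refine (TC0Pred.sumElim (ι := ι) (f := fun q (_ : I q) _ => False)
      (g := fun q => Sum.elim (fun a u => c q u a.1 = true) fun _ _ => False) .false
      (TC0Pred.sumElim (f := fun q (a : G q × Fin 6) u => c q u a.1 = true)
        (g := fun q (_ : F q) _ => False)
        (hc.comp fun k : Σ q, G q × Fin 6 => ⟨k.1, k.2.1⟩) .false)).congr ?_
    rintro ⟨q, i | a | k⟩ u <;> simp
  convert TC0Int.ite (hcond.comp fun k : Σ q, Equation (I q) (G q) (F q) ×
      (Vertex (I q) (G q) ⊕ Vertex (I q) (G q)) => ⟨k.1, k.2.1⟩)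
    (const_coeff fun q => (P q).edge) (const_coeff fun q => ((P q).mask fun _ => false).edge)
    using 3 with k u
  simp only [edgeMatrix, Matrix.of_apply, edge_mask (P k.1) (c k.1 u)]
  split_ifs <;> rfl

end AddProgram

theorem TC0Reducible.of_addProgram {𝒞 : MatrixClass} {G : ℕ × ℕ × ℕ → Type} [∀ p, Fintype (G p)]
    (hG : PolyBounded sysSize fun p => Fintype.card (G p))
    {P : ∀ p : ℕ × ℕ × ℕ, AddProgram (Option (Fin p.2.1)) (G p) (Fin p.1)}
    (hP : ∀ p k, (P p).pos k ≠ (P p).neg k)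
    {c : ∀ p : ℕ × ℕ × ℕ, (SysWire p.1 p.2.1 p.2.2 → Bool) → G p → Bool}
    (hc : TC0Pred (fun k : Σ p, G p => sysSize k.1) fun k u => c k.1 u k.2 = true)
    (hrun : ∀ p u (x : Fin p.2.1 → ℝ), ∃ z, ((P p).mask (c p u)).IsTrace z ∧
      ∀ j, z (.input (some j)) = x j)
    (hout : ∀ (K : Type) [Field K] p u (z : _ → K), ((P p).mask (c p u)).IsTrace z → ∀ i,
      z ((P p).pos i) - z ((P p).neg i) =
        ∑ j, (decodeMatrix u i j : K) * z (.input (some j))) :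
    TC0Reducible 𝒞 fun m n => classGz2 m n ∩ classMC2 m n := by
  let V : ℕ × ℕ × ℕ → Type := fun p => Vertex (Option (Fin p.2.1)) (G p)
  let ρ : ℕ × ℕ × ℕ → Type := fun p => Equation (Option (Fin p.2.1)) (G p) (Fin p.1)
  have hm : PolyBounded sysSize fun p => p.1 := .of_le fun p => by dsimp only [sysSize]; omega
  have hn : PolyBounded sysSize fun p => p.2.1 := .of_le fun p => by dsimp only [sysSize]; omega
  have hρ : PolyBounded sysSize fun p => Fintype.card (ρ p) :=
    ((hn.add (.const _ 1)).add ((hG.mul (.const _ 6)).add hm)).mono fun p => by simp [ρ]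
  have hV : PolyBounded sysSize fun p => Fintype.card (V p) :=
    (((hn.add (.const _ 1)).add (.const _ 1)).add (hG.mul (.const _ 3))).mono fun p => by
      simp [V]
  refine .of_systems hρ (hV.add hV) (fun p => Fintype.equivFin (ρ p))
    (fun p => (Equiv.sumCongr (Fintype.equivFin (V p)) (Fintype.equivFin (V p))).trans
      finSumFinEquiv)
    (A' := fun p u => edgeMatrix ((P p).mask (c p u)).edge)
    (b' := fun p u => AddProgram.edgeRhs _ _ (decodeRhs u))
    (AddProgram.tc0Int_edgeMatrix_mask (s := sysSize) (c := c) P hc) ?_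
    (fun p u => edgeMatrix_submatrix_mem _ _ (AddProgram.head_edge_ne_tail (hP p))
      (AddProgram.exists_edge_diff _))
    (fun p j => .inl (Node.input (some j)).vertex) (fun _ _ => .inl (.inl none)) ?_ ?_
  · convert TC0Rat.sumElim (ι := fun p : ℕ × ℕ × ℕ => SysWire p.1 p.2.1 p.2.2) (s := sysSize)
      (r := fun p (_ : Option (Fin p.2.1)) _ => 0)
      (r' := fun p => Sum.elim (fun _ _ => 0) fun i u => decodeRhs u i) .zero
      (TC0Rat.sumElim (r := fun p (_ : G p × Fin 6) _ => 0)
        (r' := fun p (i : Fin p.1) (u : SysWire p.1 p.2.1 p.2.2 → Bool) => decodeRhs u i)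
        .zero tc0Rat_decodeRhs) using 3 with k
    obtain ⟨p, i | a | k⟩ := k <;> rfl
  · intro p u x hx
    obtain ⟨z, hz, hzx⟩ := hrun p u x
    refine AddProgram.exists_solves_of_isTrace hz fun i => (hout ℝ p u z hz i).trans ?_
    simpa only [hzx] using hx i
  · intro K _ p u x' hx' i
    exact (hout K p u _ (AddProgram.isTrace_of_solves hx') i).symm.trans
      ((sub_sub_sub_cancel_right _ _ _).trans (AddProgram.sub_eq_of_solves hx' i))

/-! ### The program of a linear system -/

/-- The gates of the program of a system: the multiples `2 ^ t * x j` for `t ≤ w`, and for every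
row and every sign the partial sums of the products of the bits of the entries with these
multiples. The sign `false` stands for the positive entries. -/
abbrev SysGate (m n w : ℕ) : Type :=
  (Fin n × Fin (w + 1)) ⊕ (Fin m × Bool × Fin (n * w + 1))

section SysProgram

variable {m n w : ℕ}

/-- The program that evaluates the left-hand sides of a system, once the summands that belong to
the zero bits of the matrix are masked. -/
def sysProgram (m n w : ℕ) : AddProgram (Option (Fin n)) (SysGate m n w) (Fin m) where
  left
    | .inl (j, t) => Fin.cases (.input (some j)) (fun t => .gate (.inl (j, t.castSucc))) t
    | .inr (i, c, τ) => Fin.cases .zero (fun τ => .gate (.inr (i, c, τ.castSucc))) τ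
  right
    | .inl (j, t) => Fin.cases .zero (fun t => .gate (.inl (j, t.castSucc))) t
    | .inr (_, _, τ) => Fin.cases .zero
        (fun τ => .gate (.inl (τ.divNat, τ.modNat.castSucc))) τ
  pos i := .gate (.inr (i, false, Fin.last _))
  neg i := .gate (.inr (i, true, Fin.last _))

/-- The bit `t` of the entry `(i, j)` of a represented matrix if the entry has the sign `c`, and
`false` otherwise. -/
def entryBit (u : SysWire m n w → Bool) (i : Fin m) (c : Bool) (j : Fin n) (t : Fin w) : Bool :=
  u (.inl (i, j, some t)) && (u (.inl (i, j, none)) == c)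

/-- The gates whose second summand is not masked for a represented system. -/
def sysMask (u : SysWire m n w → Bool) : SysGate m n w → Bool
  | .inl _ => true
  | .inr (i, c, τ) => Fin.cases false (fun τ => entryBit u i c τ.divNat τ.modNat) τ

variable {K : Type} [Field K] {u : SysWire m n w → Bool}

/-- The term that is added in step `τ` of the summation of a row. -/
def rowTerm (u : SysWire m n w → Bool) (x : Fin n → K) (i : Fin m) (c : Bool) (τ : Fin (n * w)) :
    K :=
  if entryBit u i c τ.divNat τ.modNat then 2 ^ (τ.modNat : ℕ) * x τ.divNat else 0

theorem sum_rowTerm_sub_sum_rowTerm (u : SysWire m n w → Bool) (x : Fin n → K) (i : Fin m) :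
    ∑ τ, rowTerm u x i false τ - ∑ τ, rowTerm u x i true τ =
      ∑ j, (decodeMatrix u i j : K) * x j := by
  have sum_eq (c : Bool) : ∑ τ, rowTerm u x i c τ =
      ∑ j, ∑ t, if entryBit u i c j t then 2 ^ (t : ℕ) * x j else 0 := by
    rw [← Fintype.sum_prod_type', ← finProdFinEquiv.symm.sum_comp]
    rfl
  simp only [sum_eq, ← sum_sub_distrib]
  refine sum_congr rfl fun j _ => ?_
  simp only [decodeMatrix, intVal, natVal]
  push_cast
  rw [mul_assoc, sum_mul, mul_sum]
  refine sum_congr rfl fun t _ => ?_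
  cases hsign : u (.inl (i, j, none)) <;> cases hbit : u (.inl (i, j, some t)) <;>
    simp [entryBit, hsign, hbit]

/-- The values of the nodes when the inputs have the values `x`. -/
def sysVal (u : SysWire m n w → Bool) (x : Option (Fin n) → K) :
    Node (Option (Fin n)) (SysGate m n w) → K
  | .zero => 0
  | .input j => x j
  | .gate (.inl (j, t)) => 2 ^ (t : ℕ) * x (some j)
  | .gate (.inr (i, c, τ)) => Fin.partialSum (rowTerm u (fun j => x (some j)) i c) τ

theorem isTrace_sysVal (u : SysWire m n w → Bool) (x : Option (Fin n) → K) :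
    ((sysProgram m n w).mask (sysMask u)).IsTrace (sysVal u x) := by
  refine ⟨rfl, ?_⟩
  rintro (⟨j, t⟩ | ⟨i, c, τ⟩)
  · cases t using Fin.cases with
    | zero => simp [AddProgram.mask, sysProgram, sysMask, sysVal]
    | succ t =>
      suffices (2 : K) ^ (t + 1 : ℕ) * x (some j) =
          2 ^ (t : ℕ) * x (some j) + 2 ^ (t : ℕ) * x (some j) by
        simpa [AddProgram.mask, sysProgram, sysMask, sysVal]
      ring
  · cases τ using Fin.cases with
    | zero => simp [AddProgram.mask, sysProgram, sysMask, sysVal]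
    | succ τ =>
      by_cases hbit : entryBit u i c τ.divNat τ.modNat <;>
        simp [AddProgram.mask, sysProgram, sysMask, sysVal, Fin.partialSum_succ, rowTerm, hbit]

theorem eq_sysVal {z : Node (Option (Fin n)) (SysGate m n w) → K}
    (hz : ((sysProgram m n w).mask (sysMask u)).IsTrace z) :
    z = sysVal u fun j => z (.input j) := by
  have hmul (j : Fin n) (t : Fin (w + 1)) :
      z (.gate (.inl (j, t))) = 2 ^ (t : ℕ) * z (.input (some j)) := by
    induction t using Fin.induction with
    | zero => simp [hz.gate, hz.zero, AddProgram.mask, sysProgram, sysMask]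
    | succ t ih =>
      have hdouble := hz.gate (.inl (j, t.succ))
      simp only [AddProgram.mask, sysProgram, sysMask, Fin.cases_succ, if_true, ih] at hdouble
      rw [hdouble, Fin.val_succ, Fin.val_castSucc]
      ring
  funext v
  rcases v with _ | j | ⟨j, t⟩ | ⟨i, c, τ⟩
  · exact hz.zero
  · rfl
  · exact hmul j t
  · induction τ using Fin.induction with
    | zero => simp [hz.gate, hz.zero, AddProgram.mask, sysProgram, sysMask, sysVal]
    | succ τ ih =>
      rw [hz.gate]
      by_cases hbit : entryBit u i c τ.divNat τ.modNat <;>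
        simp [AddProgram.mask, sysProgram, sysMask, ih, sysVal, Fin.partialSum_succ, rowTerm, hbit,
          hmul, hz.zero]

theorem sub_eq_sum_decodeMatrix_mul {z : Node (Option (Fin n)) (SysGate m n w) → K}
    (hz : ((sysProgram m n w).mask (sysMask u)).IsTrace z) (i : Fin m) :
    z ((sysProgram m n w).pos i) - z ((sysProgram m n w).neg i) =
      ∑ j, (decodeMatrix u i j : K) * z (.input (some j)) := by
  have partialSum_last {k : ℕ} (f : Fin k → K) : Fin.partialSum f (Fin.last k) = ∑ j, f j := by
    rw [Fin.partialSum, Fin.val_last, List.take_of_length_le (by simp), List.sum_ofFn]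
  rw [eq_sysVal hz]
  simp only [sysProgram, sysVal, partialSum_last, sum_rowTerm_sub_sum_rowTerm]

theorem tc0Pred_entryBit :
    TC0Pred (fun k : Σ p : ℕ × ℕ × ℕ, Fin p.1 × Bool × Fin p.2.1 × Fin p.2.2 => sysSize k.1)
      fun k (u : SysWire k.1.1 k.1.2.1 k.1.2.2 → Bool) =>
        entryBit u k.2.1 k.2.2.1 k.2.2.2.1 k.2.2.2.2 = true := by
  refine ((TC0Pred.var fun k => .inl (k.2.1, k.2.2.2.1, some k.2.2.2.2)).and
    ((TC0Pred.var fun k => .inl (k.2.1, k.2.2.2.1, none)).iff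
      (.const fun k => k.2.2.1 = true))).congr fun k u => ?_
  rw [entryBit, Bool.and_eq_true, beq_iff_eq]
  exact and_congr_right' Bool.eq_iff_iff

theorem tc0Pred_sysMask :
    TC0Pred (fun k : Σ p : ℕ × ℕ × ℕ, SysGate p.1 p.2.1 p.2.2 => sysSize k.1)
      fun k (u : SysWire k.1.1 k.1.2.1 k.1.2.2 → Bool) => sysMask u k.2 = true := by
  refine .of_cover
    (Subtype.val : {k : Σ p : ℕ × ℕ × ℕ, SysGate p.1 p.2.1 p.2.2 //
      ∃ β, ∀ u, sysMask u k.2 = β} → _)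
    (fun k : Σ p : ℕ × ℕ × ℕ, Fin p.1 × Bool × Fin (p.2.1 * p.2.2) =>
      ⟨k.1, .inr (k.2.1, k.2.2.1, k.2.2.2.succ)⟩) ?_ ?_ ?_
  · rintro ⟨p, _ | ⟨i, c, τ⟩⟩
    · exact .inl ⟨⟨_, true, fun _ => rfl⟩, rfl⟩
    · cases τ using Fin.cases with
      | zero => exact .inl ⟨⟨_, false, fun _ => rfl⟩, rfl⟩
      | succ τ => exact .inr ⟨⟨p, i, c, τ⟩, rfl⟩
  · refine (TC0Pred.const fun k => ∀ u, sysMask u k.1.2 = true).congr fun k u => ?_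
    obtain ⟨β, hβ⟩ := k.2
    simp only [hβ, forall_const]
  · exact tc0Pred_entryBit.comp
      fun k : Σ p : ℕ × ℕ × ℕ, Fin p.1 × Bool × Fin (p.2.1 * p.2.2) =>
        ⟨k.1, k.2.1, k.2.2.1, k.2.2.2.divNat, k.2.2.2.modNat⟩

end SysProgram

end TC0Lin

open TC0Lin in
theorem mainTheorem5_general (𝒞 : MatrixClass) :
    TC0Reducible 𝒞 fun m n => classGz2 m n ∩ classMC2 m n := by
  have hm : PolyBounded sysSize fun p => p.1 := .of_le fun p => by dsimp only [sysSize]; omega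
  have hn : PolyBounded sysSize fun p => p.2.1 := .of_le fun p => by dsimp only [sysSize]; omega
  have hw : PolyBounded sysSize fun p => p.2.2 := .of_le fun p => by dsimp only [sysSize]; omega
  refine .of_addProgram (G := fun p => SysGate p.1 p.2.1 p.2.2)
    (P := fun p => sysProgram p.1 p.2.1 p.2.2) ?_ ?_ tc0Pred_sysMask
    (fun p u x => ⟨sysVal u (Option.elim · 0 x), isTrace_sysVal u _, fun j => rfl⟩)
    fun K _ p u z hz i => sub_eq_sum_decodeMatrix_mul hz i
  · exact ((hn.mul (hw.add (.const _ 1))).add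
      (hm.mul ((PolyBounded.const _ 2).mul ((hn.mul hw).add (.const _ 1))))).mono fun p => by simp
  · simp [sysProgram]

theorem mainTheorem5 :
    TC0Lin.TC0Reducible TC0Lin.classG TC0Lin.classGz ∧
    TC0Lin.TC0Reducible TC0Lin.classGz TC0Lin.classGz2 ∧
    TC0Lin.TC0Reducible TC0Lin.classGz2 TC0Lin.classMC2 :=
  ⟨(mainTheorem5_general _).mono_right fun _ _ _ hA => hA.1.1,
    (mainTheorem5_general _).mono_right fun _ _ _ hA => hA.1,
    (mainTheorem5_general _).mono_right fun _ _ _ hA => hA.2⟩
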